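/- Let $\mathbb K$ be a field of characteristic zero. For a $\mathbb K$-vector space $V_0$, let $V_0[[h]]$ be the $\mathbb K[[h]]$-module of formal series $\sum_{m\ge 0} v_m h^m$ with $v_m\in V_0$. A $\mathbb K[[h]]$-module is topologically free if it is isomorphic to $V_0[[h]]$ for some $\mathbb K$-vector space $V_0$. Let $\mathfrak{sl}_2$ have Chevalley generators $H,X^-,X^+$, let $\mathfrak a$ be the Lie algebra over $\mathbb K$ generated by $H,X^-,X^+$ subject to the relations $[H,X^{\pm}]=\pm 2X^{\pm}$, and let $U(\mathfrak a)\to U(\mathfrak{sl}_2)$ be the canonical (surjective) homomorphism of enveloping algebras. A colouring is a family $\psi=(\psi^k(n))_{k\ge 1,\,n\in\mathbb Z}$ of elements of $\mathbb K[[h]]$ such that $\psi^k(n)\equiv k(n-k+1) \pmod h$ for all $k\ge 1$ and $n\in\mathbb Z$; $\psi^{n+1}(n)=0$ for all $n\ge 0$; and $\psi^{n+k+1}(n)=\psi^k(-n-2)$ for all $k\ge 1$ and $n\ge 0$. It is regular if $\psi^k(n)\in \mathbb K[k,n][[h]]$, i.e. if for each $m\ge 0$ there is a polynomial $P_m$ in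 two variables over $\mathbb K$ such that the coefficient of $h^m$ in $\psi^k(n)$ is $P_m(k,n)$ for all $k\ge 1$ and $n\in\mathbb Z$. For $n\in\mathbb Z$ the deformed Verma module $V(n,\psi)$ is the $\mathbb K[[h]]$-module $\left(\bigoplus_{j\ge 0} \mathbb K\,b_j\right)[[h]]$, on which the $\mathbb K[[h]]$-algebra $U(\mathfrak a)[[h]]$ acts by $Hb_j=(n-2j)b_j$, $X^-b_j=b_{j+1}$, $X^+b_0=0$ and $X^+b_j=\psi^j(n)b_{j-1}$ for $j\ge 1$. Let $I_h(\psi)$ be the two-sided ideal of $U(\mathfrak a)[[h]]$ formed by the elements that act by zero on $V(n,\psi)$ for all $n\in\mathbb Z$, and let $U_h(\psi)=U(\mathfrak a)[[h]]/I_h(\psi)$. **Theorem.** Let $\psi$ be a colouring. The following assertions are equivalent. (i) The colouring $\psi$ is regular. (ii) $U_h(\psi)$ is a formal deformation of the $\mathbb K$-algebra $U(\mathfrak{sl}_2)$: the $\mathbb K[[h]]$-module $U_h(\psi)$ is topologically free, and the $\mathbb K$-algebras $U_h(\psi)/hU_h(\psi)$ and $U(\mathfrak{sl}_2)$ are isomorphic.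 (iii) $U_h(\psi)$ is a formal deformation of the $\mathfrak a$-algebra $U(\mathfrak{sl}_2)$: the $\mathbb K[[h]]$-module $U_h(\psi)$ is topologically free, and there is a $\mathbb K$-algebra isomorphism from $U_h(\psi)/hU_h(\psi)$ to $U(\mathfrak{sl}_2)$ that is compatible with the canonical homomorphisms from $U(\mathfrak a)$ to both algebras. -/

import Mathlib

universe u v w

open PowerSeries

attribute [local instance 100] LieRing.ofAssociativeRing

namespace CKM

noncomputable section

/-! ## Formal series with coefficients in a vector space, and in an algebra -/

/-- `V⟦h⟧`: the formal series `∑ₘ vₘ hᵐ` with coefficients `vₘ` in `V`, stored as `m ↦ vₘ`. -/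
def Series (V : Type u) : Type u := ℕ → V

namespace Series

instance (V : Type u) [AddCommGroup V] : AddCommGroup (Series V) :=
  inferInstanceAs (AddCommGroup (ℕ → V))

/-- The series with given coefficients. -/
def mk {V : Type u} (v : ℕ → V) : Series V := v

/-- The coefficient of `hᵐ`. -/
def coeff {V : Type u} (m : ℕ) (v : Series V) : V := v m

@[ext]
theorem ext {V : Type u} {v w : Series V} (h : ∀ m, v.coeff m = w.coeff m) : v = w := funext h

@[simp]
theorem coeff_mk {V : Type u} (v : ℕ → V) (m : ℕ) : (mk v).coeff m = v m := rfl

@[simp]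
theorem coeff_add {V : Type u} [AddCommGroup V] (v w : Series V) (m : ℕ) :
    (v + w).coeff m = v.coeff m + w.coeff m := rfl

@[simp]
theorem coeff_zero {V : Type u} [AddCommGroup V] (m : ℕ) : (0 : Series V).coeff m = 0 := rfl

/-- A `B`-module structure on `V` yields a `B⟦h⟧`-module structure on `V⟦h⟧`, by the Cauchy product
`(∑ᵢ bᵢ hⁱ) • (∑ⱼ vⱼ hʲ) = ∑ₘ (∑_{i + j = m} bᵢ • vⱼ) hᵐ`. -/
instance {B : Type v} {V : Type u} [Semiring B] [AddCommGroup V] [Module B V] :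
    SMul B⟦X⟧ (Series V) :=
  ⟨fun f v ↦ mk fun m ↦
    ∑ p ∈ Finset.HasAntidiagonal.antidiagonal m, PowerSeries.coeff p.1 f • v.coeff p.2⟩

theorem coeff_smul {B : Type v} {V : Type u} [Semiring B] [AddCommGroup V] [Module B V]
    (f : B⟦X⟧) (v : Series V) (m : ℕ) : (f • v).coeff m =
      ∑ p ∈ Finset.HasAntidiagonal.antidiagonal m, PowerSeries.coeff p.1 f • v.coeff p.2 := rfl

theorem coeff_C_smul {B : Type v} {V : Type u} [Semiring B] [AddCommGroup V] [Module B V]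
    (b : B) (v : Series V) (m : ℕ) : ((C b : B⟦X⟧) • v).coeff m = b • v.coeff m := by
  rw [coeff_smul, Finset.sum_eq_single (0, m)]
  · simp
  · rintro ⟨i, j⟩ hij hne
    have hi : i ≠ 0 := by
      rintro rfl
      simp at hij
      exact hne (by simp [hij])
    simp [coeff_C, hi]
  · simp

instance {B : Type v} {V : Type u} [Semiring B] [AddCommGroup V] [Module B V] :
    Module B⟦X⟧ (Series V) where
  one_smul v := by
    ext m
    simpa using coeff_C_smul (1 : B) v m
  mul_smul f g v := by
    ext m
    simp only [coeff_smul, coeff_mul, Finset.sum_smul, Finset.smul_sum, mul_smul,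
      Finset.sum_sigma']
    apply Finset.sum_nbij' (fun ⟨⟨_, j⟩, ⟨k, l⟩⟩ ↦ ⟨(k, l + j), (l, j)⟩)
      (fun ⟨⟨i, _⟩, ⟨k, l⟩⟩ ↦ ⟨(i + k, l), (i, k)⟩)
    · rintro ⟨⟨i, j⟩, ⟨k, l⟩⟩ h
      simp at h ⊢
      omega
    · rintro ⟨⟨i, j⟩, ⟨k, l⟩⟩ h
      simp at h ⊢
      omega
    · rintro ⟨⟨i, j⟩, ⟨k, l⟩⟩ h
      simp at h
      simp [h]
    · rintro ⟨⟨i, j⟩, ⟨k, l⟩⟩ h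
      simp at h
      simp [h]
    · simp
  smul_zero f := by ext m; simp [coeff_smul]
  smul_add f v w := by ext m; simp [coeff_smul, Finset.sum_add_distrib]
  add_smul f g v := by ext m; simp [coeff_smul, add_smul, Finset.sum_add_distrib]
  zero_smul v := by ext m; simp [coeff_smul]

/-- The constant series `v`, through which `V` is regarded as a subspace of `V⟦h⟧`. -/
def const {V : Type u} [AddCommGroup V] (v : V) : Series V := mk fun m ↦ if m = 0 then v else 0

end Series

/-- For a `K`-algebra `B`, the ring `B⟦h⟧` is a `K⟦h⟧`-algebra (`h` is central).
The priority is low since Mathlib has this instance for commutative `B`. -/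
instance (priority := 10) seriesAlgebra {K : Type u} {B : Type v} [CommSemiring K] [Semiring B]
    [Algebra K B] : Algebra K⟦X⟧ B⟦X⟧ where
  algebraMap := PowerSeries.map (algebraMap K B)
  smul f g := PowerSeries.map (algebraMap K B) f * g
  smul_def' _ _ := rfl
  commutes' f g := by
    ext m
    rw [coeff_mul, coeff_mul, ← Finset.Nat.sum_antidiagonal_swap]
    exact Finset.sum_congr rfl fun p _ ↦ by simp [Algebra.commutes]

theorem seriesAlgebra_smul_def {K : Type u} {B : Type v} [CommSemiring K] [Semiring B]
    [Algebra K B] (f : K⟦X⟧) (g : B⟦X⟧) :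
    f • g = PowerSeries.map (algebraMap K B) f * g := rfl

instance {K : Type u} {B : Type v} [CommSemiring K] [Semiring B] [Algebra K B] :
    IsScalarTower K K⟦X⟧ B⟦X⟧ :=
  IsScalarTower.of_algebraMap_eq fun r ↦ by
    ext m
    change _ = coeff m (PowerSeries.map (algebraMap K B) (algebraMap K K⟦X⟧ r))
    simp [PowerSeries.algebraMap_apply]

/-- The scalars `K⟦h⟧` act on `V⟦h⟧` through `B⟦h⟧`. -/
instance {K : Type u} {B : Type v} {V : Type w} [CommSemiring K] [Semiring B] [Algebra K B]
    [AddCommGroup V] [Module K V] [Module B V] [IsScalarTower K B V] :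
    IsScalarTower K⟦X⟧ B⟦X⟧ (Series V) :=
  IsScalarTower.of_algebraMap_smul fun f v ↦ by
    ext m
    change (PowerSeries.map (algebraMap K B) f • v).coeff m = _
    simp [Series.coeff_smul]

/-- The `K⟦h⟧`-algebra homomorphism `B⟦h⟧ → E⟦h⟧`, `∑ᵢ bᵢ hⁱ ↦ ∑ᵢ φ(bᵢ) hⁱ`, that extends a
`K`-algebra homomorphism `φ : B → E⟦h⟧`. -/
def extend {K : Type u} {B : Type v} {E : Type w} [CommSemiring K] [Semiring B] [Algebra K B]
    [Semiring E] [Algebra K E] (φ : B →ₐ[K] E⟦X⟧) : B⟦X⟧ →ₐ[K⟦X⟧] E⟦X⟧ where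
  toFun x := PowerSeries.mk fun m ↦
    ∑ p ∈ Finset.HasAntidiagonal.antidiagonal m, coeff p.2 (φ (coeff p.1 x))
  map_one' := by
    ext m
    rw [coeff_mk, Finset.sum_eq_single (0, m)]
    · simp
    · rintro ⟨i, j⟩ hij hne
      have hi : i ≠ 0 := by
        rintro rfl
        simp at hij
        exact hne (by simp [hij])
      simp [coeff_one, hi]
    · simp
  map_mul' x y := by
    ext m
    simp only [coeff_mul, coeff_mk, map_sum, map_mul, Finset.sum_mul_sum]
    simp only [Finset.sum_sigma']
    apply Finset.sum_nbij'
      (fun ⟨_, ⟨(a, c), (b, d)⟩⟩ ↦ ⟨(a + b, c + d), ⟨(a, b), (c, d)⟩⟩)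
      (fun ⟨_, ⟨(a, b), (c, d)⟩⟩ ↦ ⟨(a + c, b + d), ⟨(a, c), (b, d)⟩⟩)
    · rintro ⟨⟨i, j⟩, ⟨⟨a, c⟩, ⟨b, d⟩⟩⟩ h
      simp at h ⊢
      omega
    · rintro ⟨⟨i, j⟩, ⟨⟨a, c⟩, ⟨b, d⟩⟩⟩ h
      simp at h ⊢
      omega
    · rintro ⟨⟨i, j⟩, ⟨⟨a, c⟩, ⟨b, d⟩⟩⟩ h
      simp at h
      simp [h]
    · rintro ⟨⟨i, j⟩, ⟨⟨a, c⟩, ⟨b, d⟩⟩⟩ h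
      simp at h
      simp [h]
    · simp
  map_zero' := by ext m; simp
  map_add' x y := by ext m; simp [Finset.sum_add_distrib]
  commutes' f := by
    ext m
    change coeff m (PowerSeries.mk fun m ↦ ∑ p ∈ Finset.HasAntidiagonal.antidiagonal m,
      coeff p.2 (φ (coeff p.1 (PowerSeries.map (algebraMap K B) f)))) =
        coeff m (PowerSeries.map (algebraMap K E) f)
    rw [coeff_mk, Finset.sum_eq_single (m, 0)]
    · simp [PowerSeries.algebraMap_apply]
    · rintro ⟨i, j⟩ hij hne
      have hj : j ≠ 0 := by
        rintro rfl
        simp at hij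
        exact hne (by simp [hij])
      simp [PowerSeries.algebraMap_apply, coeff_C, hj]
    · simp

/-! ## The Lie algebras `sl₂` and `a`, and their universal enveloping algebras -/

/-- The generators `H`, `X⁻`, `X⁺`. -/
inductive Gen : Type
  | H
  | Xm
  | Xp

section LieAlgebras

variable (K : Type u) [Field K]

/-- The non-deformed relations `[H, X⁺] = 2 X⁺` and `[H, X⁻] = -2 X⁻`, as elements of the free Lie
algebra. -/
def nonDeformedRelations : Set (FreeLieAlgebra K Gen) :=
  {⁅FreeLieAlgebra.of K Gen.H, FreeLieAlgebra.of K Gen.Xp⁆ - (2 : K) • FreeLieAlgebra.of K Gen.Xp,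
   ⁅FreeLieAlgebra.of K Gen.H, FreeLieAlgebra.of K Gen.Xm⁆ + (2 : K) • FreeLieAlgebra.of K Gen.Xm}

/-- The ideal of the free Lie algebra generated by the non-deformed relations. -/
def relIdeal : LieIdeal K (FreeLieAlgebra K Gen) :=
  LieSubmodule.lieSpan K (FreeLieAlgebra K Gen) (nonDeformedRelations K)

/-- The Lie algebra `a` generated by `H`, `X⁻`, `X⁺` subject to the non-deformed relations. -/
abbrev LieA : Type u := FreeLieAlgebra K Gen ⧸ relIdeal K

/-- The generators of `a`. -/
def genA (g : Gen) : LieA K := LieSubmodule.Quotient.mk (FreeLieAlgebra.of K g)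

variable {K} in
/-- The universal property of `a`. -/
def liftA {L : Type v} [LieRing L] [LieAlgebra K L] (g : Gen → L)
    (hp : ⁅g Gen.H, g Gen.Xp⁆ = (2 : K) • g Gen.Xp)
    (hm : ⁅g Gen.H, g Gen.Xm⁆ = -((2 : K) • g Gen.Xm)) : LieA K →ₗ⁅K⁆ L :=
  have hle : relIdeal K ≤ (FreeLieAlgebra.lift K g).ker := by
    refine LieSubmodule.lieSpan_le.mpr ?_
    rintro x (rfl | rfl)
    · simp [hp]
    · simp [hm]
  { (relIdeal K).toSubmodule.liftQ (FreeLieAlgebra.lift K g : FreeLieAlgebra K Gen →ₗ[K] L)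
      (fun x hx ↦ by simpa using hle hx) with
    map_lie' := by
      rintro ⟨x⟩ ⟨y⟩
      exact LieHom.map_lie (FreeLieAlgebra.lift K g) x y }

variable {K} in
theorem liftA_genA {L : Type v} [LieRing L] [LieAlgebra K L] (g : Gen → L)
    (hp : ⁅g Gen.H, g Gen.Xp⁆ = (2 : K) • g Gen.Xp)
    (hm : ⁅g Gen.H, g Gen.Xm⁆ = -((2 : K) • g Gen.Xm)) (i : Gen) :
    liftA g hp hm (genA K i) = g i :=
  FreeLieAlgebra.lift_of_apply (R := K) g i

/-- The universal enveloping algebra `U(a)`. -/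
abbrev Ua : Type u := UniversalEnvelopingAlgebra K (LieA K)

/-- The Lie algebra `sl₂` of traceless `2 × 2` matrices. -/
abbrev Sl2 : Type u := LieAlgebra.SpecialLinear.sl (Fin 2) K

/-- The Chevalley generators of `sl₂`: `H = E₁₁ - E₂₂`, `X⁻ = E₂₁`, `X⁺ = E₁₂`. -/
def genSl2 : Gen → Sl2 K
  | Gen.H => LieAlgebra.SpecialLinear.singleSubSingle 0 1 1
  | Gen.Xm => LieAlgebra.SpecialLinear.single 1 0 (by decide) 1
  | Gen.Xp => LieAlgebra.SpecialLinear.single 0 1 (by decide) 1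

/-- The universal enveloping algebra `U(sl₂)`. -/
abbrev Usl2 : Type u := UniversalEnvelopingAlgebra K (Sl2 K)

/-- The projection `a → sl₂`, which sends generators to generators. -/
def aToSl2 : LieA K →ₗ⁅K⁆ Sl2 K :=
  liftA (genSl2 K)
    (by
      apply Subtype.ext
      ext i j
      fin_cases i <;> fin_cases j <;>
        simp [genSl2, Ring.lie_def,
          Matrix.single_apply, Matrix.mul_apply]
      all_goals norm_num)
    (by
      apply Subtype.ext
      ext i j
      fin_cases i <;> fin_cases j <;>
        simp [genSl2, Ring.lie_def,
          Matrix.single_apply, Matrix.mul_apply]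
      all_goals norm_num)

/-- The structural homomorphism `U(a) → U(sl₂)` of the `a`-algebra `U(sl₂)`. -/
def UaToUsl2 : Ua K →ₐ[K] Usl2 K :=
  UniversalEnvelopingAlgebra.lift K ((UniversalEnvelopingAlgebra.ι K).comp (aToSl2 K))

/-- The constant formal deformation `U_h(a) = U(a)⟦h⟧`. -/
abbrev Uha : Type u := (Ua K)⟦X⟧

end LieAlgebras

/-! ## Colourings and deformed Verma modules -/

/-- A colouring `ψ = (ψᵏ)_{k ≥ 1}`, where each `ψᵏ` takes values `ψᵏ(n) ∈ K⟦h⟧` for `n ∈ ℤ`;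
`ψᵏ(n)` is `val k n`, and the value at `k = 0` is never used. -/
structure Colouring (K : Type u) [Field K] where
  val : ℕ → ℤ → K⟦X⟧
  /-- `ψᵏ(n) = k (n - k + 1)` modulo `h`. -/
  constantCoeff_val : ∀ k : ℕ, 1 ≤ k → ∀ n : ℤ,
    constantCoeff (val k n) = (k : K) * ((n : K) - (k : K) + 1)
  /-- `ψⁿ⁺¹(n) = 0` for `n ≥ 0`. -/
  val_succ_self : ∀ n : ℕ, val (n + 1) (n : ℤ) = 0
  /-- `ψⁿ⁺ᵏ⁺¹(n) = ψᵏ(-n-2)` for `k ≥ 1` and `n ≥ 0`. -/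
  val_reflect : ∀ k : ℕ, 1 ≤ k → ∀ n : ℕ, val (n + k + 1) (n : ℤ) = val k (-(n : ℤ) - 2)

section Verma

variable {K : Type u} [Field K]

/-- A colouring is regular if `ψᵏ(n) ∈ K[k, n]⟦h⟧`: there is a formal series in `h` with
coefficients in the polynomial ring in two variables whose value at `(k, n)` is `ψᵏ(n)`. -/
def Colouring.IsRegular (ψ : Colouring K) : Prop :=
  ∃ P : (MvPolynomial (Fin 2) K)⟦X⟧, ∀ k : ℕ, 1 ≤ k → ∀ n : ℤ,
    ψ.val k n = PowerSeries.map (MvPolynomial.eval ![(k : K), (n : K)]) P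

variable (K) in
/-- The vector space `⨁_{k ≥ 0} K b_k`, with `b_k = Finsupp.single k 1`. -/
abbrev VermaSpace : Type u := ℕ →₀ K

/-- The `h`-expansion of the action of the generators on the deformed Verma module:
`H b_k = (n - 2k) b_k`, `X⁻ b_k = b_{k+1}`, `X⁺ b_0 = 0` and `X⁺ b_{k+1} = ψᵏ⁺¹(n) b_k`. -/
def genAction (ψ : Colouring K) (n : ℤ) : Gen → (Module.End K (VermaSpace K))⟦X⟧
  | Gen.H => C (Finsupp.linearCombination K fun k ↦
      ((n : K) - 2 * (k : K)) • Finsupp.single k 1)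
  | Gen.Xm => C (Finsupp.linearCombination K fun k ↦ Finsupp.single (k + 1) 1)
  | Gen.Xp => PowerSeries.mk fun m ↦ Finsupp.linearCombination K fun k ↦
      match k with
      | 0 => 0
      | k + 1 => coeff m (ψ.val (k + 1) n) • Finsupp.single k 1

theorem genAction_rel_Xp (ψ : Colouring K) (n : ℤ) :
    ⁅genAction ψ n Gen.H, genAction ψ n Gen.Xp⁆ = (2 : K) • genAction ψ n Gen.Xp := by
  rw [LieRing.of_associative_ring_bracket]
  ext m : 1
  refine Finsupp.lhom_ext' fun k ↦ LinearMap.ext_ring ?_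
  change (coeff m (genAction ψ n Gen.H * genAction ψ n Gen.Xp) -
      coeff m (genAction ψ n Gen.Xp * genAction ψ n Gen.H)) (Finsupp.single k 1) =
    (2 : K) • coeff m (genAction ψ n Gen.Xp) (Finsupp.single k 1)
  cases k with
  | zero =>
    simp only [genAction, coeff_C_mul, coeff_mul_C, coeff_mk, LinearMap.sub_apply,
      Module.End.mul_apply, Finsupp.linearCombination_single, map_smul, one_smul, smul_zero,
      map_zero, sub_zero]
  | succ k =>
    simp only [genAction, coeff_C_mul, coeff_mul_C, coeff_mk, LinearMap.sub_apply,
      Module.End.mul_apply, Finsupp.linearCombination_single, map_smul, one_smul]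
    push_cast
    module

theorem genAction_rel_Xm (ψ : Colouring K) (n : ℤ) :
    ⁅genAction ψ n Gen.H, genAction ψ n Gen.Xm⁆ = -((2 : K) • genAction ψ n Gen.Xm) := by
  rw [LieRing.of_associative_ring_bracket]
  ext m : 1
  refine Finsupp.lhom_ext' fun k ↦ LinearMap.ext_ring ?_
  change (coeff m (genAction ψ n Gen.H * genAction ψ n Gen.Xm) -
      coeff m (genAction ψ n Gen.Xm * genAction ψ n Gen.H)) (Finsupp.single k 1) =
    -((2 : K) • coeff m (genAction ψ n Gen.Xm) (Finsupp.single k 1))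
  by_cases hm : m = 0
  · simp only [genAction, hm, coeff_mul_C, coeff_zero_C, LinearMap.sub_apply,
      Module.End.mul_apply, Finsupp.linearCombination_single, map_smul, one_smul]
    push_cast
    module
  · simp [genAction, coeff_C, hm]

/-- The representation of `U_h(a)` on `V(n, ψ) = (⨁_{k ≥ 0} K b_k)⟦h⟧`. -/
def vermaRep (ψ : Colouring K) (n : ℤ) :
    Uha K →ₐ[K⟦X⟧] Module.End K⟦X⟧ (Series (VermaSpace K)) :=
  (Algebra.lsmul K⟦X⟧ K⟦X⟧ (Series (VermaSpace K)) :
      (Module.End K (VermaSpace K))⟦X⟧ →ₐ[K⟦X⟧] _).comp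
    (extend (UniversalEnvelopingAlgebra.lift K
      (liftA (genAction ψ n) (genAction_rel_Xp ψ n) (genAction_rel_Xm ψ n))))

/-- The generators of `U(a)`, regarded as elements of `U_h(a)`. -/
def genUha (K : Type u) [Field K] (g : Gen) : Uha K :=
  C (UniversalEnvelopingAlgebra.ι K (genA K g))

theorem extend_C {B : Type v} {E : Type w} [Semiring B] [Algebra K B]
    [Semiring E] [Algebra K E] (φ : B →ₐ[K] E⟦X⟧) (b : B) : extend φ (C b) = φ b := by
  ext m
  change coeff m (PowerSeries.mk fun m ↦ ∑ p ∈ Finset.HasAntidiagonal.antidiagonal m,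
    coeff p.2 (φ (coeff p.1 (C b)))) = _
  rw [coeff_mk, Finset.sum_eq_single (0, m)]
  · simp
  · rintro ⟨i, j⟩ hij hne
    have hi : i ≠ 0 := by
      rintro rfl
      simp at hij
      exact hne (by simp [hij])
    simp [coeff_C, hi]
  · simp

theorem vermaRep_genUha (ψ : Colouring K) (n : ℤ) (g : Gen) (v : Series (VermaSpace K)) :
    vermaRep ψ n (genUha K g) v = genAction ψ n g • v := by
  rw [genUha]
  change extend (UniversalEnvelopingAlgebra.lift K (liftA (genAction ψ n) _ _))
    (C (UniversalEnvelopingAlgebra.ι K (genA K g))) • v = _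
  rw [extend_C, UniversalEnvelopingAlgebra.lift_ι_apply, liftA_genA]

variable (K) in
/-- The element `b_k` of the deformed Verma modules. -/
def vermaB (k : ℕ) : Series (VermaSpace K) := Series.const (Finsupp.single k 1)

theorem smul_const_coeff {B : Type v} {V : Type w} [Semiring B] [AddCommGroup V] [Module B V]
    (f : B⟦X⟧) (v : V) (m : ℕ) : (f • Series.const v).coeff m = coeff m f • v := by
  rw [Series.coeff_smul, Finset.sum_eq_single (m, 0)]
  · simp [Series.const]
  · rintro ⟨i, j⟩ hij hne
    have hj : j ≠ 0 := by
      rintro rfl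
      simp at hij
      exact hne (by simp [hij])
    simp [Series.const, hj]
  · simp

/-- `H b_k = (n - 2k) b_k`. -/
theorem vermaRep_H (ψ : Colouring K) (n : ℤ) (k : ℕ) :
    vermaRep ψ n (genUha K Gen.H) (vermaB K k) =
      (C ((n : K) - 2 * (k : K)) : K⟦X⟧) • vermaB K k := by
  rw [vermaRep_genUha]
  ext m : 1
  rw [vermaB, smul_const_coeff, smul_const_coeff, genAction, coeff_C, coeff_C]
  split_ifs
  · rw [Module.End.smul_def, Finsupp.linearCombination_single, one_smul]
  · rw [zero_smul, zero_smul]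

/-- `X⁻ b_k = b_{k+1}`. -/
theorem vermaRep_Xm (ψ : Colouring K) (n : ℤ) (k : ℕ) :
    vermaRep ψ n (genUha K Gen.Xm) (vermaB K k) = vermaB K (k + 1) := by
  rw [vermaRep_genUha]
  ext m : 1
  rw [vermaB, smul_const_coeff]
  by_cases hm : m = 0 <;> simp [genAction, coeff_C, hm, vermaB, Series.const]

/-- `X⁺ b_0 = 0`. -/
theorem vermaRep_Xp_zero (ψ : Colouring K) (n : ℤ) :
    vermaRep ψ n (genUha K Gen.Xp) (vermaB K 0) = 0 := by
  rw [vermaRep_genUha]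
  ext m : 1
  rw [vermaB, smul_const_coeff]
  simp [genAction]

/-- `X⁺ b_k = ψᵏ(n) b_{k-1}` for `k ≥ 1`. -/
theorem vermaRep_Xp_succ (ψ : Colouring K) (n : ℤ) (k : ℕ) :
    vermaRep ψ n (genUha K Gen.Xp) (vermaB K (k + 1)) = ψ.val (k + 1) n • vermaB K k := by
  rw [vermaRep_genUha]
  ext m : 1
  rw [vermaB, vermaB, smul_const_coeff, smul_const_coeff]
  simp [genAction]

/-- The ideal `I_h(ψ)` of the elements of `U_h(a)` that act by zero on `V(n, ψ)` for all `n`. -/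
def Ih (ψ : Colouring K) : Ideal (Uha K) := ⨅ n : ℤ, RingHom.ker (vermaRep ψ n)

instance (ψ : Colouring K) : (Ih ψ).IsTwoSided :=
  inferInstanceAs (⨅ n : ℤ, RingHom.ker (vermaRep ψ n)).IsTwoSided

/-- The `U_h(a)`-algebra `U_h(ψ) = U_h(a) / I_h(ψ)`. -/
abbrev Uh (ψ : Colouring K) : Type u := Uha K ⧸ Ih ψ

end Verma

/-! ## Formal deformations -/

section Deformations

variable (K : Type u) [Field K]

/-- A `K⟦h⟧`-module is topologically free if it is isomorphic to `V₀⟦h⟧` for some `K`-vector space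
`V₀`. -/
def TopologicallyFree (M : Type v) [AddCommGroup M] [Module K⟦X⟧ M] : Prop :=
  ∃ (V₀ : Type v) (_ : AddCommGroup V₀) (_ : Module K V₀), Nonempty (M ≃ₗ[K⟦X⟧] Series V₀)

/-- The two-sided ideal `hA` of a `K⟦h⟧`-algebra `A`. -/
def hIdeal (A : Type v) [Ring A] [Algebra K⟦X⟧ A] : Ideal A where
  carrier := {x | ∃ y : A, x = (X : K⟦X⟧) • y}
  zero_mem' := ⟨0, by simp⟩
  add_mem' := by
    rintro _ _ ⟨y, rfl⟩ ⟨z, rfl⟩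
    exact ⟨y + z, by simp⟩
  smul_mem' := by
    rintro a _ ⟨y, rfl⟩
    exact ⟨a * y, by simp⟩

instance (A : Type v) [Ring A] [Algebra K⟦X⟧ A] : (hIdeal K A).IsTwoSided :=
  ⟨by
    rintro _ b ⟨y, rfl⟩
    exact ⟨y * b, by simp⟩⟩

/-- The `K⟦h⟧`-algebra `A` is a formal deformation of the `K`-algebra `A₀`: it is topologically
free, and the `K`-algebras `A₀` and `A / hA` are isomorphic. -/
def IsFormalDeformation (A₀ : Type v) [Ring A₀] [Algebra K A₀] (A : Type w) [Ring A] [Algebra K A]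
    [Algebra K⟦X⟧ A] [IsScalarTower K K⟦X⟧ A] : Prop :=
  TopologicallyFree K A ∧ Nonempty (A₀ ≃ₐ[K] A ⧸ hIdeal K A)

/-- The `B₀⟦h⟧`-algebra `A`, with structural homomorphism `s : B₀⟦h⟧ → A`, is a formal deformation
of the `B₀`-algebra `A₀`, with structural homomorphism `s₀ : B₀ → A₀`: it is topologically free, and
the `B₀`-algebras `A / hA` and `A₀` are isomorphic, where `b ∈ B₀` acts on `A / hA` as the class of
`s b`. -/
def IsFormalDeformationOver {B₀ : Type u} [Ring B₀] [Algebra K B₀] {A₀ : Type v} [Ring A₀]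
    [Algebra K A₀] (s₀ : B₀ →ₐ[K] A₀) {A : Type w} [Ring A] [Algebra K A] [Algebra K⟦X⟧ A]
    [IsScalarTower K K⟦X⟧ A] (s : B₀⟦X⟧ →ₐ[K⟦X⟧] A) : Prop :=
  TopologicallyFree K A ∧
    ∃ e : (A ⧸ hIdeal K A) ≃ₐ[K] A₀, ∀ b : B₀, e (Ideal.Quotient.mk _ (s (C b))) = s₀ b

end Deformations

end

end CKM

/-!
Write `A = U(a)`, and let `I₀ ⊆ A` be the set of the constant terms of the elements of `I_h(ψ)`.

The ideal `I_h(ψ)` is the kernel of the action of `A⟦h⟧` on the spaces `V⟦h⟧`, where `V` has the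
basis `b_0, b_1, …`. It is therefore closed in the `h`-adic topology and contains `x` as soon as it
contains `h x`, so that `U_h(ψ)` is isomorphic to `W⟦h⟧` for each complement `W` of `I₀` in `A`
(`topologicallyFree_Uh`). Hence topological freeness holds for all colourings, and the theorem is
about the algebra `U_h(ψ) / h U_h(ψ) = A / I₀`.

Modulo `h`, the deformed Verma modules are the classical ones, and these separate the elements of
`U(sl₂)` (`eq_zero_of_classicalAction_eq_zero`). So `I₀` is contained in the kernel of
`A → U(sl₂)`, and there is a canonical surjection `A / I₀ → U(sl₂)` (`UhModToUsl2`). Thus `U_h(ψ)`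
is a deformation of the `a`-algebra `U(sl₂)` exactly if `I₀` contains the element
`X⁺ X⁻ - X⁻ X⁺ - H`, which generates this kernel (`isFormalDeformationOver_iff`).

For this it suffices to have a deformation of the algebra `U(sl₂)`: an isomorphism
`U(sl₂) ≃ A / I₀`, followed by the canonical surjection, is a surjective endomorphism of `U(sl₂)`.
Such an endomorphism is injective, since the twist by it of a simple module is simple of the same
dimension, hence isomorphic to the module (`injective_of_surjective_endomorphism`).

A deformation has a regular colouring: if `X⁺ X⁻ - X⁻ X⁺ - H` acts as `h y`, then the coefficient
of `hᵐ⁺¹` in `ψʲ⁺¹(n) - ψʲ(n)` is a matrix coefficient of `y`, which involves only the coefficients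
of `ψ` up to `hᵐ`. By induction on `m`, it is polynomial in `(j, n)`, and so is its sum over `j`
(`exists_polynomial_valCoeff`).

A regular colouring gives a deformation: by the axioms of a colouring, the polynomials that express
`ψᵏ(n)` are invariant under the reflection `(k, n) ↦ (k - n - 1, -n - 2)` and vanish at `k = 0`. The
invariant polynomials are the polynomials in `n - 2k` and `(n + 1)²`, which are the values modulo `h`
of `H` and of the Casimir element. By successive approximation, each series of invariant polynomials
is the action of an element of `A⟦h⟧` (`exists_actsBy`). This applies to the action of
`X⁺ X⁻ - X⁻ X⁺ - H`, divided by `h`.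
-/

namespace CKM

noncomputable section

/-! ### The ideal `I_h(ψ)` through its action on the deformed Verma modules -/

theorem coeff_extend {K : Type u} {B : Type v} {E : Type w} [CommSemiring K] [Semiring B]
    [Algebra K B] [Semiring E] [Algebra K E] (φ : B →ₐ[K] E⟦X⟧) (x : B⟦X⟧) (m : ℕ) :
    coeff m (extend φ x) =
      ∑ p ∈ Finset.HasAntidiagonal.antidiagonal m, coeff p.2 (φ (coeff p.1 x)) := by
  change coeff m (PowerSeries.mk fun m ↦ ∑ p ∈ Finset.HasAntidiagonal.antidiagonal m,
    coeff p.2 (φ (coeff p.1 x))) = _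
  rw [coeff_mk]

theorem seriesAlgebra_X_smul {K : Type u} {B : Type v} [CommSemiring K] [Semiring B]
    [Algebra K B] (f : B⟦X⟧) : (X : K⟦X⟧) • f = X * f := by
  rw [seriesAlgebra_smul_def, PowerSeries.map_X]

/-- The generators of `U(a)`. -/
def genUa (K : Type u) [Field K] (g : Gen) : Ua K := UniversalEnvelopingAlgebra.ι K (genA K g)

variable {K : Type u} [Field K]

theorem hom_ext_ua {B : Type v} [Ring B] [Algebra K B] {φ φ' : Ua K →ₐ[K] B}
    (h : ∀ g, φ (genUa K g) = φ' (genUa K g)) : φ = φ' := by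
  apply UniversalEnvelopingAlgebra.hom_ext
  apply LieHom.ext
  intro x
  obtain ⟨y, rfl⟩ := LieSubmodule.Quotient.surjective_mk' (relIdeal K) x
  let q : FreeLieAlgebra K Gen →ₗ⁅K⁆ LieA K :=
    { (LieSubmodule.Quotient.mk' (relIdeal K) : FreeLieAlgebra K Gen →ₗ[K] LieA K) with
      map_lie' := rfl }
  have key : ((φ : Ua K →ₗ⁅K⁆ B).comp (UniversalEnvelopingAlgebra.ι K)).comp q =
      ((φ' : Ua K →ₗ⁅K⁆ B).comp (UniversalEnvelopingAlgebra.ι K)).comp q := by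
    apply FreeLieAlgebra.hom_ext
    intro g
    exact h g
  exact LieHom.congr_fun key y

theorem genUa_rel_Xp : ⁅genUa K Gen.H, genUa K Gen.Xp⁆ = (2 : K) • genUa K Gen.Xp := by
  rw [genUa, genUa, ← LieHom.map_lie, ← map_smul]
  congr 1
  exact (Submodule.Quotient.eq _).mpr (LieSubmodule.subset_lieSpan (Or.inl rfl))

theorem genUa_rel_Xm : ⁅genUa K Gen.H, genUa K Gen.Xm⁆ = -((2 : K) • genUa K Gen.Xm) := by
  rw [genUa, genUa, ← LieHom.map_lie, ← map_smul, ← map_neg]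
  congr 1
  refine (Submodule.Quotient.eq _).mpr (LieSubmodule.subset_lieSpan (Or.inr ?_))
  rw [Set.mem_singleton_iff, sub_neg_eq_add]

/-- The generators of `U(a)` generate it as an algebra. -/
theorem adjoin_genUa : Algebra.adjoin K (Set.range (genUa K)) = ⊤ := by
  let S := Algebra.adjoin K (Set.range (genUa K))
  let g : Gen → S := fun i ↦ ⟨genUa K i, Algebra.subset_adjoin ⟨i, rfl⟩⟩
  let φ : Ua K →ₐ[K] S := UniversalEnvelopingAlgebra.lift K (liftA g
    (Subtype.ext genUa_rel_Xp) (Subtype.ext genUa_rel_Xm))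
  have h : S.val.comp φ = AlgHom.id K (Ua K) := by
    refine hom_ext_ua fun i ↦ ?_
    change ((φ (genUa K i) : S) : Ua K) = _
    have : φ (genUa K i) = g i := by
      rw [genUa, UniversalEnvelopingAlgebra.lift_ι_apply, liftA_genA]
    rw [this]
    rfl
  refine eq_top_iff.mpr fun x _ ↦ ?_
  have hx : ((φ x : S) : Ua K) = x := DFunLike.congr_fun h x
  rw [← hx]
  exact (φ x).2

/-- The action of `U(a)` on `V(n, ψ)`, expanded in powers of `h`. -/
def uaAction (ψ : Colouring K) (n : ℤ) : Ua K →ₐ[K] (Module.End K (VermaSpace K))⟦X⟧ :=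
  UniversalEnvelopingAlgebra.lift K
    (liftA (genAction ψ n) (genAction_rel_Xp ψ n) (genAction_rel_Xm ψ n))

theorem uaAction_genUa (ψ : Colouring K) (n : ℤ) (g : Gen) :
    uaAction ψ n (genUa K g) = genAction ψ n g := by
  rw [uaAction, genUa, UniversalEnvelopingAlgebra.lift_ι_apply, liftA_genA]

/-- The action of `U_h(a)` on `V(n, ψ)`, expanded in powers of `h`. -/
def uhaAction (ψ : Colouring K) (n : ℤ) : Uha K →ₐ[K⟦X⟧] (Module.End K (VermaSpace K))⟦X⟧ :=
  extend (uaAction ψ n)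

theorem uhaAction_C (ψ : Colouring K) (n : ℤ) (b : Ua K) :
    uhaAction ψ n (C b) = uaAction ψ n b := extend_C _ _

theorem mem_Ih {ψ : Colouring K} {x : Uha K} : x ∈ Ih ψ ↔ ∀ n, uhaAction ψ n x = 0 := by
  rw [Ih, Ideal.mem_iInf]
  refine forall_congr' fun n ↦ ?_
  rw [RingHom.mem_ker]
  change Algebra.lsmul K⟦X⟧ K⟦X⟧ (Series (VermaSpace K)) (uhaAction ψ n x) = 0 ↔ _
  constructor
  · intro h
    ext m : 1
    refine LinearMap.ext fun v ↦ ?_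
    have h1 := congrArg (fun f ↦ (f (Series.const v)).coeff m) h
    simpa [smul_const_coeff] using h1
  · intro h
    rw [h, map_zero]

/-- `U_h(ψ)` has no `h`-torsion. -/
theorem mem_Ih_of_X_mul_mem {ψ : Colouring K} {x : Uha K} (h : X * x ∈ Ih ψ) : x ∈ Ih ψ := by
  rw [mem_Ih] at h ⊢
  intro n
  have h1 := h n
  rw [← seriesAlgebra_X_smul (K := K), map_smul, seriesAlgebra_X_smul] at h1
  ext m : 1
  rw [← coeff_succ_X_mul, h1]
  simp

theorem coeff_uhaAction_congr {ψ : Colouring K} {n : ℤ} {m : ℕ} {x y : Uha K}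
    (h : ∀ i ≤ m, coeff i x = coeff i y) :
    coeff m (uhaAction ψ n x) = coeff m (uhaAction ψ n y) := by
  rw [uhaAction, coeff_extend, coeff_extend]
  refine Finset.sum_congr rfl fun p hp ↦ ?_
  rw [h p.1 (by simp at hp; omega)]

/-- `I_h(ψ)` is closed in the `h`-adic topology. -/
theorem mem_Ih_of_approx {ψ : Colouring K} {x : Uha K}
    (h : ∀ m, ∃ y ∈ Ih ψ, ∀ i ≤ m, coeff i x = coeff i y) : x ∈ Ih ψ := by
  rw [mem_Ih]
  intro n
  ext m : 1
  obtain ⟨y, hy, hxy⟩ := h m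
  rw [coeff_uhaAction_congr hxy, mem_Ih.mp hy n]

/-! ### Successive approximation modulo powers of `h` -/

/-- A relation between formal series that is additive, stable under multiplication by `h`, closed
in the `h`-adic topology, and that can be solved modulo `h`, can be solved. -/
theorem exists_series_of_solvable_mod {A : Type v} {B : Type w} [AddCommGroup A] [AddCommGroup B]
    (E : Series A → Series B → Prop)
    (add : ∀ z z' F F', E z F → E z' F' → E (z + z') (F + F'))
    (shift : ∀ z F, E z F → E (Series.mk fun m ↦ Nat.casesOn m 0 z.coeff)
      (Series.mk fun m ↦ Nat.casesOn m 0 F.coeff))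
    (closed : ∀ z F, (∀ m, ∃ z' F', E z' F' ∧ (∀ i ≤ m, z.coeff i = z'.coeff i) ∧
      ∀ i ≤ m, F.coeff i = F'.coeff i) → E z F)
    (solve : ∀ b : B, ∃ a F, E (Series.const a) F ∧ F.coeff 0 = b) (F : Series B) :
    ∃ z, E z F := by
  choose a G hE hG using solve
  -- `R i` is what remains of `F` after `i` steps, divided by `hⁱ`.
  let next : Series B → Series B := fun F ↦ Series.mk fun m ↦
    F.coeff (m + 1) - (G (F.coeff 0)).coeff (m + 1)
  let R : ℕ → Series B := fun i ↦ next^[i] F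
  let z : Series A := Series.mk fun i ↦ a ((R i).coeff 0)
  have key : ∀ m i, ∃ z' F', E z' F' ∧ (∀ j ≤ m, z.coeff (i + j) = z'.coeff j) ∧
      ∀ j ≤ m, (R i).coeff j = F'.coeff j := by
    intro m
    induction m with
    | zero =>
      intro i
      refine ⟨_, _, hE ((R i).coeff 0), ?_, ?_⟩
      · intro j hj
        obtain rfl : j = 0 := by omega
        simp [z, Series.const]
      · intro j hj
        obtain rfl : j = 0 := by omega
        rw [hG]
    | succ m ih =>
      intro i
      obtain ⟨z', F', h, hz, hF⟩ := ih (i + 1)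
      refine ⟨_, _, add _ _ _ _ (hE ((R i).coeff 0)) (shift _ _ h), ?_, ?_⟩
      · intro j hj
        cases j with
        | zero => simp [z, Series.const]
        | succ j =>
          have := hz j (by omega)
          rw [add_right_comm] at this
          simpa [Series.const, add_assoc] using this
      · intro j hj
        cases j with
        | zero => simp [hG]
        | succ j =>
          have h1 := hF j (by omega)
          have h2 : R (i + 1) = next (R i) := Function.iterate_succ_apply' _ _ _
          rw [h2] at h1
          simp only [Series.coeff_add, Series.coeff_mk, ← h1, next]
          abel
  refine ⟨z, closed _ _ fun m ↦ ?_⟩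
  obtain ⟨z', F', h, hz, hF⟩ := key m 0
  exact ⟨z', F', h, fun i hi ↦ by simpa using hz i hi, hF⟩

/-! ### `U_h(ψ)` is topologically free -/

/-- The constant terms of the elements of `I_h(ψ)`. -/
def constIh (ψ : Colouring K) : Submodule K (Ua K) where
  carrier := {b | ∃ x ∈ Ih ψ, constantCoeff x = b}
  zero_mem' := ⟨0, Submodule.zero_mem _, map_zero _⟩
  add_mem' := by
    rintro _ _ ⟨x, hx, rfl⟩ ⟨y, hy, rfl⟩
    exact ⟨x + y, add_mem hx hy, map_add _ _ _⟩
  smul_mem' := by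
    rintro c _ ⟨x, hx, rfl⟩
    refine ⟨C (algebraMap K (Ua K) c) * x, Ideal.mul_mem_left _ _ hx, ?_⟩
    rw [map_mul, constantCoeff_C, Algebra.smul_def]

/-- A complement `W` of the constant terms of `I_h(ψ)` in `U(a)` yields an isomorphism from `W⟦h⟧`
to `U_h(ψ)`: `I_h(ψ)` is closed, and `U_h(ψ)` has no `h`-torsion. -/
theorem topologicallyFree_Uh (ψ : Colouring K) : TopologicallyFree K (Uh ψ) := by
  obtain ⟨W, hW⟩ := Submodule.exists_isCompl (constIh ψ)
  let toUha : Series W → Uha K := fun w ↦ PowerSeries.mk fun m ↦ ((w.coeff m : W) : Ua K)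
  have coeff_toUha : ∀ w m, coeff m (toUha w) = w.coeff m := fun w m ↦ PowerSeries.coeff_mk _ _
  let f : Series W →ₗ[K⟦X⟧] Uh ψ :=
    { toFun w := Ideal.Quotient.mk _ (toUha w)
      map_add' v w := by
        rw [← map_add]
        congr 1
      map_smul' c w := by
        change _ = c • Ideal.Quotient.mkₐ K⟦X⟧ (Ih ψ) (toUha w)
        rw [← map_smul]
        change _ = Ideal.Quotient.mk (Ih ψ) _
        congr 1
        ext m
        rw [seriesAlgebra_smul_def, coeff_mul, coeff_toUha, Series.coeff_smul]
        simp [coeff_toUha, Algebra.smul_def] }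
  refine ⟨W, inferInstance, inferInstance, ⟨(LinearEquiv.ofBijective f ⟨?_, ?_⟩).symm⟩⟩
  · rw [injective_iff_map_eq_zero]
    intro w hw
    replace hw : toUha w ∈ Ih ψ := Ideal.Quotient.eq_zero_iff_mem.mp hw
    by_contra hne
    have hex : ∃ m, w.coeff m ≠ 0 := by
      by_contra! h
      exact hne (Series.ext h)
    -- Division by `hᵐ` reduces the claim to the constant term, which lies in `W` and in
    -- `constIh ψ`.
    have hdiv : ∀ m, ∀ w : Series W, toUha w ∈ Ih ψ → (∀ i < m, w.coeff i = 0) →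
        w.coeff m = 0 := by
      intro m
      induction m with
      | zero =>
        intro w hw _
        refine Subtype.ext (Submodule.disjoint_def.mp hW.disjoint _ ⟨_, hw, ?_⟩ (w.coeff 0).2)
        rw [← coeff_zero_eq_constantCoeff_apply, coeff_toUha]
      | succ m ih =>
        intro w hw h0
        refine ih (Series.mk fun i ↦ w.coeff (i + 1)) (mem_Ih_of_X_mul_mem ?_)
          fun i hi ↦ h0 (i + 1) (by omega)
        convert hw using 1
        ext i
        cases i with
        | zero => simp [coeff_toUha, h0]
        | succ i => simp [coeff_succ_X_mul, coeff_toUha]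
    classical
    exact Nat.find_spec hex (hdiv _ w hw fun i hi ↦ not_not.mp (Nat.find_min hex hi))
  · intro y
    obtain ⟨x, rfl⟩ := Ideal.Quotient.mk_surjective y
    let toS : Uha K → Series (Ua K) := fun x ↦ Series.mk fun m ↦ coeff m x
    let ofS : Series (Ua K) → Uha K := fun x ↦ PowerSeries.mk fun m ↦ x.coeff m
    obtain ⟨w, hw⟩ := exists_series_of_solvable_mod (A := W) (B := Ua K)
      (fun w F ↦ ofS F - toUha w ∈ Ih ψ)
      (by
        intro z z' F F' h h'
        convert add_mem h h' using 1
        ext m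
        simp [ofS, coeff_toUha]
        abel)
      (by
        intro z F h
        convert Ideal.mul_mem_left _ (X : Uha K) h using 1
        ext m
        cases m with
        | zero => simp [ofS, toUha]
        | succ m => simp [ofS, toUha, coeff_succ_X_mul])
      (by
        intro z F h
        refine mem_Ih_of_approx fun m ↦ ?_
        obtain ⟨z', F', h', hz, hF⟩ := h m
        refine ⟨_, h', fun i hi ↦ ?_⟩
        simp [ofS, coeff_toUha, hz i hi, hF i hi])
      (by
        intro b
        obtain ⟨i, ⟨x, hx, hi⟩, w, hw, rfl⟩ :=
          Submodule.mem_sup.mp (hW.sup_eq_top ▸ Submodule.mem_top : b ∈ constIh ψ ⊔ W)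
        refine ⟨⟨w, hw⟩, toS (x + C w), ?_, ?_⟩
        · convert hx using 1
          ext m
          rw [map_sub, coeff_toUha]
          by_cases hm : m = 0 <;> simp [ofS, toS, Series.const, coeff_C, hm]
        · simp [toS, hi])
      (toS x)
    refine ⟨w, (Ideal.Quotient.eq.mpr ?_).symm⟩
    convert hw using 2
    ext m
    simp [ofS, toS]

/-! ### The presentation of `sl₂` and the classical Verma modules -/

/-- The universal property of `sl₂`, presented by the Chevalley generators and their relations. -/
def liftSl2 {L : Type v} [LieRing L] [LieAlgebra K L] (g : Gen → L)
    (hp : ⁅g Gen.H, g Gen.Xp⁆ = (2 : K) • g Gen.Xp)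
    (hm : ⁅g Gen.H, g Gen.Xm⁆ = -((2 : K) • g Gen.Xm))
    (hh : ⁅g Gen.Xp, g Gen.Xm⁆ = g Gen.H) : Sl2 K →ₗ⁅K⁆ L where
  toFun x := x.1 0 0 • g Gen.H + x.1 0 1 • g Gen.Xp + x.1 1 0 • g Gen.Xm
  map_add' x y := by
    have h : (x + y).1 = x.1 + y.1 := rfl
    simp only [h, Matrix.add_apply, add_smul]
    abel
  map_smul' c x := by
    have h : (c • x).1 = c • x.1 := rfl
    simp only [h, Matrix.smul_apply, smul_eq_mul, mul_smul, smul_add, RingHom.id_apply]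
  map_lie' := by
    intro x y
    have tr : ∀ z : Sl2 K, z.1 1 1 = -z.1 0 0 := fun z ↦ by
      have := LinearMap.mem_ker.mp z.2
      rw [Matrix.traceLinearMap_apply, Matrix.trace_fin_two] at this
      exact eq_neg_of_add_eq_zero_right this
    have hp' : ⁅g Gen.Xp, g Gen.H⁆ = -((2 : K) • g Gen.Xp) := by rw [← lie_skew, hp]
    have hm' : ⁅g Gen.Xm, g Gen.H⁆ = (2 : K) • g Gen.Xm := by rw [← lie_skew, hm, neg_neg]
    have hh' : ⁅g Gen.Xm, g Gen.Xp⁆ = -g Gen.H := by rw [← lie_skew, hh]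
    simp only [LieSubalgebra.coe_bracket, Ring.lie_def, Matrix.sub_apply, Matrix.mul_apply,
      Fin.sum_univ_two, tr, add_lie, lie_add, smul_lie, lie_smul, lie_self, hp, hm, hh, hp',
      hm', hh']
    module

theorem liftSl2_genSl2 {L : Type v} [LieRing L] [LieAlgebra K L] (g : Gen → L)
    (hp : ⁅g Gen.H, g Gen.Xp⁆ = (2 : K) • g Gen.Xp)
    (hm : ⁅g Gen.H, g Gen.Xm⁆ = -((2 : K) • g Gen.Xm))
    (hh : ⁅g Gen.Xp, g Gen.Xm⁆ = g Gen.H) (i : Gen) :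
    liftSl2 g hp hm hh (genSl2 K i) = g i := by
  change (genSl2 K i).1 0 0 • g Gen.H + (genSl2 K i).1 0 1 • g Gen.Xp +
    (genSl2 K i).1 1 0 • g Gen.Xm = g i
  cases i <;> simp [genSl2]

theorem sl2_eq_combination (x : Sl2 K) :
    x = x.1 0 0 • genSl2 K Gen.H + x.1 0 1 • genSl2 K Gen.Xp + x.1 1 0 • genSl2 K Gen.Xm := by
  have tr : x.1 1 1 = -x.1 0 0 := by
    have := LinearMap.mem_ker.mp x.2
    rw [Matrix.traceLinearMap_apply, Matrix.trace_fin_two] at this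
    exact eq_neg_of_add_eq_zero_right this
  apply Subtype.ext
  ext i j
  fin_cases i <;> fin_cases j <;> simp [genSl2, tr]

/-- The Chevalley generators of `U(sl₂)`. -/
def genUsl2 (K : Type u) [Field K] (g : Gen) : Usl2 K :=
  UniversalEnvelopingAlgebra.ι K (genSl2 K g)

theorem UaToUsl2_genUa (g : Gen) : UaToUsl2 K (genUa K g) = genUsl2 K g := by
  rw [UaToUsl2, genUa, UniversalEnvelopingAlgebra.lift_ι_apply, LieHom.comp_apply, aToSl2,
    liftA_genA, genUsl2]

theorem hom_ext_usl2 {B : Type v} [Ring B] [Algebra K B] {φ φ' : Usl2 K →ₐ[K] B}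
    (h : ∀ g, φ (genUsl2 K g) = φ' (genUsl2 K g)) : φ = φ' := by
  apply UniversalEnvelopingAlgebra.hom_ext
  apply LieHom.ext
  intro x
  rw [sl2_eq_combination x]
  simp only [map_add, map_smul]
  congr 1
  · congr 1
    · exact congrArg _ (h Gen.H)
    · exact congrArg _ (h Gen.Xp)
  · exact congrArg _ (h Gen.Xm)

theorem genUsl2_rel_Xp :
    ⁅genUsl2 K Gen.H, genUsl2 K Gen.Xp⁆ = (2 : K) • genUsl2 K Gen.Xp := by
  rw [← UaToUsl2_genUa, ← UaToUsl2_genUa, ← AlgHom.coe_toLieHom, ← LieHom.map_lie, genUa_rel_Xp,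
    map_smul]

theorem genUsl2_rel_Xm :
    ⁅genUsl2 K Gen.H, genUsl2 K Gen.Xm⁆ = -((2 : K) • genUsl2 K Gen.Xm) := by
  rw [← UaToUsl2_genUa, ← UaToUsl2_genUa, ← AlgHom.coe_toLieHom, ← LieHom.map_lie, genUa_rel_Xm,
    map_neg, map_smul]

theorem genUsl2_rel_H : ⁅genUsl2 K Gen.Xp, genUsl2 K Gen.Xm⁆ = genUsl2 K Gen.H := by
  rw [genUsl2, genUsl2, ← LieHom.map_lie, genUsl2]
  congr 1
  apply Subtype.ext
  ext i j
  fin_cases i <;> fin_cases j <;>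
    simp [genSl2, Ring.lie_def]

/-- The generators of `U(sl₂)` generate it as an algebra. -/
theorem adjoin_genUsl2 : Algebra.adjoin K (Set.range (genUsl2 K)) = ⊤ := by
  let S := Algebra.adjoin K (Set.range (genUsl2 K))
  let g : Gen → S := fun i ↦ ⟨genUsl2 K i, Algebra.subset_adjoin ⟨i, rfl⟩⟩
  let φ : Usl2 K →ₐ[K] S := UniversalEnvelopingAlgebra.lift K (liftSl2 g
    (Subtype.ext genUsl2_rel_Xp) (Subtype.ext genUsl2_rel_Xm) (Subtype.ext genUsl2_rel_H))
  have h : S.val.comp φ = AlgHom.id K (Usl2 K) := by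
    refine hom_ext_usl2 fun i ↦ ?_
    change ((φ (genUsl2 K i) : S) : Usl2 K) = _
    have : φ (genUsl2 K i) = g i := by
      rw [genUsl2, UniversalEnvelopingAlgebra.lift_ι_apply, liftSl2_genSl2]
    rw [this]
    rfl
  refine eq_top_iff.mpr fun x _ ↦ ?_
  have hx : ((φ x : S) : Usl2 K) = x := DFunLike.congr_fun h x
  rw [← hx]
  exact (φ x).2

theorem UaToUsl2_surjective : Function.Surjective (UaToUsl2 K) := by
  rw [← AlgHom.range_eq_top, eq_top_iff, ← adjoin_genUsl2, Algebra.adjoin_le_iff]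
  rintro _ ⟨g, rfl⟩
  exact ⟨genUa K g, UaToUsl2_genUa g⟩

/-- The action of the generators on the classical Verma module of highest weight `n`. -/
def classicalGen (K : Type u) [Field K] (n : ℤ) : Gen → Module.End K (VermaSpace K)
  | Gen.H => Finsupp.linearCombination K fun k ↦ ((n : K) - 2 * (k : K)) • Finsupp.single k 1
  | Gen.Xm => Finsupp.linearCombination K fun k ↦ Finsupp.single (k + 1) 1
  | Gen.Xp => Finsupp.linearCombination K fun k ↦
      match k with
      | 0 => 0
      | k + 1 => (((k : K) + 1) * ((n : K) - k)) • Finsupp.single k 1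

theorem classicalGen_H (n : ℤ) (k : ℕ) : classicalGen K n Gen.H (Finsupp.single k 1) =
    ((n : K) - 2 * (k : K)) • Finsupp.single k 1 := by
  rw [classicalGen, Finsupp.linearCombination_single, one_smul]

theorem classicalGen_Xm (n : ℤ) (k : ℕ) : classicalGen K n Gen.Xm (Finsupp.single k 1) =
    Finsupp.single (k + 1) 1 := by
  rw [classicalGen, Finsupp.linearCombination_single, one_smul]

theorem classicalGen_Xp_zero (n : ℤ) : classicalGen K n Gen.Xp (Finsupp.single 0 1) = 0 := by
  rw [classicalGen, Finsupp.linearCombination_single, one_smul]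

theorem classicalGen_Xp_succ (n : ℤ) (k : ℕ) :
    classicalGen K n Gen.Xp (Finsupp.single (k + 1) 1) =
      (((k : K) + 1) * ((n : K) - k)) • Finsupp.single k 1 := by
  rw [classicalGen, Finsupp.linearCombination_single, one_smul]

/-- The action of `U(sl₂)` on the classical Verma module of highest weight `n`. -/
def classicalAction (K : Type u) [Field K] (n : ℤ) : Usl2 K →ₐ[K] Module.End K (VermaSpace K) :=
  UniversalEnvelopingAlgebra.lift K (liftSl2 (classicalGen K n)
    (by
      rw [Ring.lie_def]
      refine Finsupp.lhom_ext' fun k ↦ LinearMap.ext_ring ?_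
      change classicalGen K n Gen.H (classicalGen K n Gen.Xp (Finsupp.single k 1)) -
        classicalGen K n Gen.Xp (classicalGen K n Gen.H (Finsupp.single k 1)) =
        (2 : K) • classicalGen K n Gen.Xp (Finsupp.single k 1)
      cases k with
      | zero =>
        simp only [classicalGen_H, classicalGen_Xp_zero, map_smul, map_zero, smul_zero, sub_zero]
      | succ k =>
        simp only [classicalGen_H, classicalGen_Xp_succ, map_smul]
        push_cast
        module)
    (by
      rw [Ring.lie_def]
      refine Finsupp.lhom_ext' fun k ↦ LinearMap.ext_ring ?_
      change classicalGen K n Gen.H (classicalGen K n Gen.Xm (Finsupp.single k 1)) -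
        classicalGen K n Gen.Xm (classicalGen K n Gen.H (Finsupp.single k 1)) =
        -((2 : K) • classicalGen K n Gen.Xm (Finsupp.single k 1))
      simp only [classicalGen_H, classicalGen_Xm, map_smul]
      push_cast
      module)
    (by
      rw [Ring.lie_def]
      refine Finsupp.lhom_ext' fun k ↦ LinearMap.ext_ring ?_
      change classicalGen K n Gen.Xp (classicalGen K n Gen.Xm (Finsupp.single k 1)) -
        classicalGen K n Gen.Xm (classicalGen K n Gen.Xp (Finsupp.single k 1)) =
        classicalGen K n Gen.H (Finsupp.single k 1)
      cases k with
      | zero =>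
        simp only [classicalGen_H, classicalGen_Xm, classicalGen_Xp_zero, classicalGen_Xp_succ,
          map_zero]
        push_cast
        module
      | succ k =>
        simp only [classicalGen_H, classicalGen_Xm, classicalGen_Xp_succ, map_smul]
        push_cast
        module))

theorem classicalAction_gen (n : ℤ) (g : Gen) :
    classicalAction K n (genUsl2 K g) = classicalGen K n g := by
  rw [classicalAction, genUsl2, UniversalEnvelopingAlgebra.lift_ι_apply, liftSl2_genSl2]

/-- Modulo `h`, the deformed Verma modules are the classical ones. -/
theorem constantCoeff_uaAction (ψ : Colouring K) (n : ℤ) (b : Ua K) :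
    constantCoeff (uaAction ψ n b) = classicalAction K n (UaToUsl2 K b) := by
  let c : (Module.End K (VermaSpace K))⟦X⟧ →ₐ[K] Module.End K (VermaSpace K) :=
    { (constantCoeff : (Module.End K (VermaSpace K))⟦X⟧ →+* Module.End K (VermaSpace K)) with
      commutes' := fun r ↦ by
        change constantCoeff (algebraMap K (Module.End K (VermaSpace K))⟦X⟧ r) = _
        rw [PowerSeries.algebraMap_apply, constantCoeff_C] }
  suffices h : c.comp (uaAction ψ n) = (classicalAction K n).comp (UaToUsl2 K) from
    AlgHom.congr_fun h b
  refine hom_ext_ua (B := Module.End K (VermaSpace K)) fun g ↦ ?_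
  change constantCoeff (uaAction ψ n (genUa K g)) = classicalAction K n (UaToUsl2 K (genUa K g))
  rw [uaAction_genUa, UaToUsl2_genUa, classicalAction_gen]
  cases g with
  | H => rw [genAction, constantCoeff_C, classicalGen]
  | Xm => rw [genAction, constantCoeff_C, classicalGen]
  | Xp =>
    rw [genAction, constantCoeff_mk]
    refine Finsupp.lhom_ext' fun k ↦ LinearMap.ext_ring ?_
    cases k with
    | zero =>
      refine Eq.trans ?_ (classicalGen_Xp_zero n).symm
      refine (Finsupp.linearCombination_single K _ _).trans ?_
      rw [one_smul]
    | succ k =>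
      refine Eq.trans ?_ (classicalGen_Xp_succ n k).symm
      refine (Finsupp.linearCombination_single K _ _).trans ?_
      rw [one_smul]
      simp only [coeff_zero_eq_constantCoeff_apply]
      rw [ψ.constantCoeff_val _ (Nat.succ_pos k)]
      push_cast
      congr 2
      ring

/-! ### The finite-dimensional quotients of Verma modules separate the elements of `U(sl₂)` -/

theorem mul_aeval_of_semiconj {A : Type v} [Ring A] [Algebra K A] {h e : A}
    (he : e * h = (h - (2 : K) • 1) * e) (p : Polynomial K) :
    e * Polynomial.aeval h p =
      Polynomial.aeval h (p.comp (Polynomial.X - Polynomial.C 2)) * e := by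
  have key : SemiconjBy e h (h - (2 : K) • 1) := he
  rw [Polynomial.aeval_comp]
  have h2 : Polynomial.aeval h (Polynomial.X - Polynomial.C (2 : K)) = h - (2 : K) • 1 := by
    rw [map_sub, Polynomial.aeval_X, Polynomial.aeval_C, Algebra.algebraMap_eq_smul_one]
  rw [h2]
  induction p using Polynomial.induction_on' with
  | add p q hp hq => rw [map_add, map_add, mul_add, add_mul, hp, hq]
  | monomial i a =>
    rw [Polynomial.aeval_monomial, Polynomial.aeval_monomial, ← mul_assoc, mul_assoc _ _ e,
      ← (key.pow_right i).eq, ← mul_assoc, Algebra.commutes]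

theorem mul_pow_succ_of_sl2 {A : Type v} [Ring A] [Algebra K A] {h e f : A}
    (hf : h * f = f * h - (2 : K) • f) (hef : e * f = f * e + h) (a : ℕ) :
    e * f ^ (a + 1) =
      f ^ (a + 1) * e + ((a : K) + 1) • (f ^ a * h) - (((a : K) + 1) * a) • f ^ a := by
  induction a with
  | zero => simp [hef]
  | succ a ih =>
    have h1 : f ^ (a + 1) * e * f = f ^ (a + 1 + 1) * e + f ^ (a + 1) * h := by
      rw [mul_assoc, hef, mul_add, ← mul_assoc, ← pow_succ]
    have h2 : f ^ a * h * f = f ^ (a + 1) * h - (2 : K) • f ^ (a + 1) := by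
      rw [mul_assoc, hf, mul_sub, ← mul_assoc, ← pow_succ, mul_smul_comm, ← pow_succ]
    rw [pow_succ f (a + 1), ← mul_assoc, ih]
    simp only [add_mul, sub_mul, smul_mul_assoc, h1, h2, ← pow_succ]
    push_cast
    module

theorem mul_pow_of_sl2 {A : Type v} [Ring A] [Algebra K A] {h f : A}
    (hf : h * f = f * h - (2 : K) • f) (a : ℕ) :
    h * f ^ a = f ^ a * (h - (2 * a : K) • 1) := by
  induction a with
  | zero => simp
  | succ a ih =>
    rw [pow_succ, ← mul_assoc, ih, mul_assoc, mul_assoc, sub_mul, hf, smul_mul_assoc, one_mul]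
    congr 1
    simp only [mul_sub, mul_smul_comm, mul_one]
    push_cast
    module

theorem genUsl2_H_mul_Xm : genUsl2 K Gen.H * genUsl2 K Gen.Xm =
    genUsl2 K Gen.Xm * genUsl2 K Gen.H - (2 : K) • genUsl2 K Gen.Xm := by
  have := genUsl2_rel_Xm (K := K)
  rw [Ring.lie_def, sub_eq_iff_eq_add] at this
  rw [this]
  abel

theorem genUsl2_Xp_mul_H : genUsl2 K Gen.Xp * genUsl2 K Gen.H =
    (genUsl2 K Gen.H - (2 : K) • 1) * genUsl2 K Gen.Xp := by
  have := genUsl2_rel_Xp (K := K)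
  rw [Ring.lie_def, sub_eq_iff_eq_add] at this
  rw [sub_mul, this, smul_mul_assoc, one_mul]
  abel

theorem genUsl2_Xp_mul_Xm : genUsl2 K Gen.Xp * genUsl2 K Gen.Xm =
    genUsl2 K Gen.Xm * genUsl2 K Gen.Xp + genUsl2 K Gen.H := by
  have := genUsl2_rel_H (K := K)
  rw [Ring.lie_def, sub_eq_iff_eq_add] at this
  rw [this, add_comm]

/-- The linear map that sends a family of polynomials `p_{a, c}` to the ordered expression
`∑ (X⁻)ᵃ p_{a, c}(H) (X⁺)ᶜ` in `U(sl₂)`. -/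
def orderedSum (K : Type u) [Field K] : (ℕ × ℕ →₀ Polynomial K) →ₗ[K] Usl2 K :=
  Finsupp.lsum K fun p ↦
    (LinearMap.mulLeft K (genUsl2 K Gen.Xm ^ p.1)).comp
      ((LinearMap.mulRight K (genUsl2 K Gen.Xp ^ p.2)).comp
        (Polynomial.aeval (genUsl2 K Gen.H)).toLinearMap)

theorem orderedSum_single (a c : ℕ) (p : Polynomial K) :
    orderedSum K (Finsupp.single (a, c) p) = genUsl2 K Gen.Xm ^ a *
      (Polynomial.aeval (genUsl2 K Gen.H) p * genUsl2 K Gen.Xp ^ c) := by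
  simp [orderedSum]

/-- The spanning half of the Poincaré-Birkhoff-Witt theorem for `sl₂`. -/
theorem orderedSum_surjective : Function.Surjective (orderedSum K) := by
  let R := LinearMap.range (orderedSum K)
  have hgen : ∀ g, ∀ x ∈ R, genUsl2 K g * x ∈ R := by
    rintro g _ ⟨F, rfl⟩
    induction F using Finsupp.induction_linear with
    | zero => simp
    | add F G hF hG =>
      rw [map_add, mul_add]
      exact add_mem hF hG
    | single p q =>
      obtain ⟨a, c⟩ := p
      rw [orderedSum_single, ← mul_assoc]
      cases g with
      | H =>
        refine ⟨Finsupp.single (a, c) ((Polynomial.X - Polynomial.C (2 * a : K)) * q), ?_⟩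
        rw [orderedSum_single, mul_pow_of_sl2 genUsl2_H_mul_Xm, map_mul, map_sub,
          Polynomial.aeval_X, Polynomial.aeval_C, Algebra.algebraMap_eq_smul_one]
        simp only [mul_assoc]
      | Xm =>
        refine ⟨Finsupp.single (a + 1, c) q, ?_⟩
        rw [orderedSum_single, pow_succ']
      | Xp =>
        have hsplit : ∀ x : Usl2 K, genUsl2 K Gen.Xm ^ a * genUsl2 K Gen.Xp *
            (Polynomial.aeval (genUsl2 K Gen.H) q * x) = genUsl2 K Gen.Xm ^ a *
            (Polynomial.aeval (genUsl2 K Gen.H) (q.comp (Polynomial.X - Polynomial.C 2)) *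
              (genUsl2 K Gen.Xp * x)) := fun x ↦ by
          rw [mul_assoc, ← mul_assoc (genUsl2 K Gen.Xp),
            mul_aeval_of_semiconj genUsl2_Xp_mul_H, mul_assoc]
        cases a with
        | zero =>
          refine ⟨Finsupp.single (0, c + 1) (q.comp (Polynomial.X - Polynomial.C 2)), ?_⟩
          have := hsplit (genUsl2 K Gen.Xp ^ c)
          rw [pow_zero, one_mul] at this
          rw [orderedSum_single, pow_zero, mul_one, this, pow_succ']
        | succ a =>
          refine ⟨Finsupp.single (a + 1, c + 1) (q.comp (Polynomial.X - Polynomial.C 2)) +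
            Finsupp.single (a, c)
              (((a : K) + 1) • (Polynomial.X * q) - (((a : K) + 1) * a) • q), ?_⟩
          rw [map_add, orderedSum_single, orderedSum_single,
            mul_pow_succ_of_sl2 genUsl2_H_mul_Xm genUsl2_Xp_mul_Xm, sub_mul,
            add_mul (genUsl2 K Gen.Xm ^ (a + 1) * genUsl2 K Gen.Xp), hsplit,
            pow_succ' _ c, map_sub, map_smul, map_smul, map_mul, Polynomial.aeval_X]
          simp only [sub_mul, mul_sub, smul_mul_assoc, mul_smul_comm, mul_assoc]
          abel
  have hall : ∀ y : Usl2 K, ∀ x ∈ R, y * x ∈ R := by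
    intro y
    have hy : y ∈ Algebra.adjoin K (Set.range (genUsl2 K)) := by simp [adjoin_genUsl2]
    induction hy using Algebra.adjoin_induction with
    | mem y hy =>
      obtain ⟨g, rfl⟩ := hy
      exact hgen g
    | algebraMap r =>
      intro x hx
      rw [← Algebra.smul_def]
      exact R.smul_mem r hx
    | add y z _ _ hy hz =>
      intro x hx
      rw [add_mul]
      exact add_mem (hy x hx) (hz x hx)
    | mul y z _ _ hy hz =>
      intro x hx
      rw [mul_assoc]
      exact hy _ (hz x hx)
  intro y
  have h1 : (1 : Usl2 K) ∈ R := ⟨Finsupp.single (0, 0) 1, by simp [orderedSum_single]⟩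
  have := hall y 1 h1
  rwa [mul_one] at this

theorem classicalAction_Xm_pow (n : ℤ) (a j : ℕ) :
    classicalAction K n (genUsl2 K Gen.Xm ^ a) (Finsupp.single j 1) =
      Finsupp.single (j + a) 1 := by
  induction a with
  | zero => simp
  | succ a ih =>
    rw [pow_succ', map_mul, Module.End.mul_apply, ih, classicalAction_gen, classicalGen_Xm,
      add_assoc]

theorem classicalAction_aeval_H (n : ℤ) (p : Polynomial K) :
    classicalAction K n (Polynomial.aeval (genUsl2 K Gen.H) p) (Finsupp.single 0 1) =
      p.eval (n : K) • Finsupp.single 0 1 := by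
  rw [← Polynomial.aeval_algHom_apply, classicalAction_gen]
  refine Module.End.aeval_apply_of_hasEigenvector ⟨?_, by simp⟩
  rw [Module.End.mem_eigenspace_iff, classicalGen_H]
  simp

theorem classicalAction_Xp_pow_of_lt (n : ℤ) {j c : ℕ} (h : j < c) :
    classicalAction K n (genUsl2 K Gen.Xp ^ c) (Finsupp.single j 1) = 0 := by
  induction c generalizing j with
  | zero => omega
  | succ c ih =>
    rw [pow_succ, map_mul, Module.End.mul_apply, classicalAction_gen]
    cases j with
    | zero => rw [classicalGen_Xp_zero, map_zero]
    | succ j => rw [classicalGen_Xp_succ, map_smul, ih (by omega), smul_zero]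

theorem exists_classicalAction_Xp_pow_self [CharZero K] (n c : ℕ) (h : c ≤ n) :
    ∃ γ : K, γ ≠ 0 ∧ classicalAction K n (genUsl2 K Gen.Xp ^ c) (Finsupp.single c 1) =
      γ • Finsupp.single 0 1 := by
  induction c with
  | zero => exact ⟨1, one_ne_zero, by simp⟩
  | succ c ih =>
    obtain ⟨γ, hγ, hc⟩ := ih (by omega)
    refine ⟨((c : K) + 1) * (n - c) * γ, ?_, ?_⟩
    · refine mul_ne_zero (mul_ne_zero (Nat.cast_add_one_ne_zero c) ?_) hγ
      rw [sub_ne_zero]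
      exact_mod_cast (by omega : n ≠ c)
    · rw [pow_succ, map_mul, Module.End.mul_apply, classicalAction_gen, classicalGen_Xp_succ,
        map_smul, hc, smul_smul, Int.cast_natCast]

/-- An element of `U(sl₂)` is zero if its matrix coefficients vanish on the simple quotients of
the Verma modules of dominant highest weights: if `c` is the least power of `X⁺` that occurs in
an ordered expression, then the action on `b_c` determines the coefficients of `(X⁺)ᶜ`. -/
theorem eq_zero_of_classicalAction_eq_zero [CharZero K] (x : Usl2 K)
    (hx : ∀ n j a : ℕ, j ≤ n → a ≤ n → classicalAction K n x (Finsupp.single j 1) a = 0) :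
    x = 0 := by
  obtain ⟨F, rfl⟩ := orderedSum_surjective x
  suffices hF : ∀ c a, F (a, c) = 0 by
    have : F = 0 := Finsupp.ext fun p ↦ hF p.2 p.1
    rw [this, map_zero]
  intro c
  induction c using Nat.strong_induction_on with
  | _ c ih =>
  intro a
  refine Polynomial.eq_zero_of_infinite_isRoot _ (Set.Infinite.mono (s := Set.range
    fun i : ℕ ↦ ((i + max a c : ℕ) : K)) ?_ (Set.infinite_range_of_injective ?_))
  · rintro _ ⟨i, rfl⟩
    let n := i + max a c
    obtain ⟨γ, hγ, hc⟩ := exists_classicalAction_Xp_pow_self (K := K) n c (by omega)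
    have h0 := hx n c a (by omega) (by omega)
    have hterm : ∀ p : ℕ × ℕ, classicalAction K n (genUsl2 K Gen.Xm ^ p.1 *
        (Polynomial.aeval (genUsl2 K Gen.H) (F p) * genUsl2 K Gen.Xp ^ p.2))
          (Finsupp.single c 1) a = if p = (a, c) then γ * (F p).eval (n : K) else 0 := by
      rintro ⟨a', c'⟩
      rw [map_mul, map_mul, Module.End.mul_apply, Module.End.mul_apply]
      rcases lt_trichotomy c' c with hlt | rfl | hgt
      · rw [ih c' hlt, if_neg (by simp; omega)]
        simp
      · rw [hc, map_smul, classicalAction_aeval_H, map_smul, map_smul, classicalAction_Xm_pow]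
        by_cases haa : a' = a <;> simp [haa]
      · rw [classicalAction_Xp_pow_of_lt _ hgt, if_neg (by simp; omega)]
        simp
    have hsum : orderedSum K F = F.sum fun p q ↦ genUsl2 K Gen.Xm ^ p.1 *
        (Polynomial.aeval (genUsl2 K Gen.H) q * genUsl2 K Gen.Xp ^ p.2) := by
      conv_lhs => rw [← Finsupp.sum_single F]
      rw [map_finsuppSum]
      exact Finsupp.sum_congr fun p _ ↦ orderedSum_single _ _ _
    rw [hsum, Finsupp.sum, map_sum, LinearMap.sum_apply, Finsupp.finsetSum_apply] at h0
    simp only [hterm] at h0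
    rw [Finset.sum_ite_eq'] at h0
    by_cases hm : (a, c) ∈ F.support
    · rw [if_pos hm] at h0
      exact (mul_eq_zero.mp h0).resolve_left hγ
    · rw [Finsupp.notMem_support_iff.mp hm]
      exact Polynomial.eval_zero
  · intro i j hij
    have : i + max a c = j + max a c := Nat.cast_injective hij
    omega

/-! ### Surjective endomorphisms of `U(sl₂)` are injective -/

/-- The span of the `b_k` with `k > n` in the Verma module of highest weight `n`. -/
def vermaTail (K : Type u) [Field K] (n : ℕ) : Submodule K (VermaSpace K) :=
  Finsupp.supported K K (Set.Ioi n)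

theorem mem_vermaTail {n : ℕ} {v : VermaSpace K} : v ∈ vermaTail K n ↔ ∀ a ≤ n, v a = 0 := by
  rw [vermaTail, Finsupp.mem_supported']
  simp

theorem single_mem_vermaTail {n k : ℕ} (h : n < k) : Finsupp.single k 1 ∈ vermaTail K n := by
  rw [mem_vermaTail]
  intro a ha
  rw [Finsupp.single_eq_of_ne (by omega)]

theorem classicalAction_mem_vermaTail (n : ℕ) (x : Usl2 K) :
    ∀ v ∈ vermaTail K n, classicalAction K n x v ∈ vermaTail K n := by
  have hx : x ∈ Algebra.adjoin K (Set.range (genUsl2 K)) := by simp [adjoin_genUsl2]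
  induction hx using Algebra.adjoin_induction with
  | mem x hx =>
    obtain ⟨g, rfl⟩ := hx
    rw [classicalAction_gen]
    suffices vermaTail K n ≤ (vermaTail K n).comap (classicalGen K n g) from this
    conv_lhs => rw [vermaTail, Finsupp.supported_eq_span_single]
    rw [Submodule.span_le]
    rintro _ ⟨k, hk, rfl⟩
    replace hk : n < k := hk
    change classicalGen K n g (Finsupp.single k 1) ∈ vermaTail K n
    cases g with
    | H =>
      rw [classicalGen_H]
      exact Submodule.smul_mem _ _ (single_mem_vermaTail hk)
    | Xm =>
      rw [classicalGen_Xm]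
      exact single_mem_vermaTail (by omega)
    | Xp =>
      obtain ⟨k, rfl⟩ : ∃ j, k = j + 1 := ⟨k - 1, by omega⟩
      rw [classicalGen_Xp_succ]
      -- The vector `b_{n+1}` is singular.
      rcases (by omega : k = n ∨ n < k) with rfl | hk
      · simp
      · exact Submodule.smul_mem _ _ (single_mem_vermaTail hk)
  | algebraMap r =>
    intro v hv
    rw [AlgHom.commutes, Module.algebraMap_end_apply]
    exact Submodule.smul_mem _ _ hv
  | add x y _ _ hx hy =>
    intro v hv
    rw [map_add]
    exact add_mem (hx v hv) (hy v hv)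
  | mul x y _ _ hx hy =>
    intro v hv
    rw [map_mul]
    exact hx _ (hy v hv)

/-- The space of the simple `sl₂`-module of highest weight `n`, with basis `b_0, …, b_n`. -/
abbrev SimpleSpace (K : Type u) [Field K] (n : ℕ) : Type u := Fin (n + 1) →₀ K

/-- The projection of a Verma module on its simple quotient. -/
def toSimple (K : Type u) [Field K] (n : ℕ) : VermaSpace K →ₗ[K] SimpleSpace K n :=
  Finsupp.lcomapDomain Fin.val Fin.val_injective

/-- The linear section `b_k ↦ b_k` of the projection of a Verma module on its simple quotient. -/
def ofSimple (K : Type u) [Field K] (n : ℕ) : SimpleSpace K n →ₗ[K] VermaSpace K :=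
  Finsupp.lmapDomain K K Fin.val

theorem ofSimple_single (n : ℕ) (i : Fin (n + 1)) :
    ofSimple K n (Finsupp.single i 1) = Finsupp.single (i : ℕ) 1 := by
  simp [ofSimple]

theorem toSimple_ofSimple (n : ℕ) (v : SimpleSpace K n) : toSimple K n (ofSimple K n v) = v :=
  Finsupp.leftInverse_lcomapDomain_mapDomain (R := K) Fin.val Fin.val_injective v

theorem toSimple_single (n : ℕ) (i : Fin (n + 1)) :
    toSimple K n (Finsupp.single (i : ℕ) 1) = Finsupp.single i 1 := by
  rw [← ofSimple_single, toSimple_ofSimple]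

theorem toSimple_eq_zero {n : ℕ} {v : VermaSpace K} : toSimple K n v = 0 ↔ v ∈ vermaTail K n := by
  rw [mem_vermaTail]
  constructor
  · intro h a ha
    exact DFunLike.congr_fun h (⟨a, by omega⟩ : Fin (n + 1))
  · intro h
    ext i
    exact h i (by omega)

theorem toSimple_classicalAction (n : ℕ) (x : Usl2 K) (v : VermaSpace K) :
    toSimple K n (classicalAction K n x (ofSimple K n (toSimple K n v))) =
      toSimple K n (classicalAction K n x v) := by
  rw [← sub_eq_zero, ← map_sub, ← map_sub, toSimple_eq_zero]
  apply classicalAction_mem_vermaTail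
  rw [← toSimple_eq_zero, map_sub, toSimple_ofSimple, sub_self]

/-- The simple `sl₂`-module of highest weight `n`. -/
def simpleAction (K : Type u) [Field K] (n : ℕ) :
    Usl2 K →ₐ[K] Module.End K (SimpleSpace K n) where
  toFun x := toSimple K n ∘ₗ classicalAction K n x ∘ₗ ofSimple K n
  map_one' := by
    refine LinearMap.ext fun v ↦ ?_
    simp [toSimple_ofSimple]
  map_mul' x y := by
    refine LinearMap.ext fun v ↦ ?_
    simp [toSimple_classicalAction]
  map_zero' := by simp
  map_add' x y := by
    refine LinearMap.ext fun v ↦ ?_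
    simp
  commutes' r := by
    refine LinearMap.ext fun v ↦ ?_
    simp [toSimple_ofSimple]

theorem simpleAction_apply (n : ℕ) (x : Usl2 K) (v : SimpleSpace K n) :
    simpleAction K n x v = toSimple K n (classicalAction K n x (ofSimple K n v)) := rfl

theorem simpleAction_simple [CharZero K] (n : ℕ) (S : Submodule K (SimpleSpace K n))
    (hS : ∀ x, ∀ v ∈ S, simpleAction K n x v ∈ S) (hne : S ≠ ⊥) : S = ⊤ := by
  obtain ⟨v, hv, hv0⟩ := Submodule.exists_mem_ne_zero_of_ne_bot hne
  -- If `b_c` is the last basis vector that occurs in `v`, then `(X⁺)ᶜ` sends `v` to a multiple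
  -- of `b_0`.
  have hsupp : v.support.Nonempty := Finsupp.support_nonempty_iff.mpr hv0
  let c := v.support.max' hsupp
  have hc : v c ≠ 0 := Finsupp.mem_support_iff.mp (Finset.max'_mem _ hsupp)
  obtain ⟨γ, hγ, hγc⟩ := exists_classicalAction_Xp_pow_self (K := K) n c (by omega)
  have h0 : simpleAction K n (genUsl2 K Gen.Xp ^ (c : ℕ)) v =
      (v c * γ) • Finsupp.single 0 1 := by
    conv_lhs => rw [← Finsupp.sum_single v, Finsupp.sum, map_sum]
    rw [Finset.sum_eq_single c]
    · rw [← mul_one (v c), ← smul_eq_mul, ← Finsupp.smul_single, map_smul, simpleAction_apply,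
        ofSimple_single, hγc, map_smul, smul_smul, smul_eq_mul, mul_one]
      exact congrArg _ (toSimple_single n 0)
    · intro j hj hjc
      have hlt : j < c := lt_of_le_of_ne (Finset.le_max' _ _ hj) hjc
      rw [← mul_one (v j), ← smul_eq_mul, ← Finsupp.smul_single, map_smul, simpleAction_apply,
        ofSimple_single, classicalAction_Xp_pow_of_lt _ hlt, map_zero, smul_zero]
    · intro h
      exact absurd (Finset.max'_mem _ hsupp) h
  have hb0 : Finsupp.single 0 1 ∈ S := by
    have := hS (genUsl2 K Gen.Xp ^ (c : ℕ)) v hv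
    rw [h0] at this
    exact (Submodule.smul_mem_iff _ (mul_ne_zero hc hγ)).mp this
  rw [eq_top_iff]
  intro w _
  rw [← Finsupp.sum_single w]
  refine Submodule.sum_mem _ fun i _ ↦ ?_
  rw [← mul_one (w i), ← smul_eq_mul, ← Finsupp.smul_single]
  refine Submodule.smul_mem _ _ ?_
  have := hS (genUsl2 K Gen.Xm ^ (i : ℕ)) _ hb0
  rw [simpleAction_apply, ofSimple_single, classicalAction_Xm_pow, Fin.val_zero, zero_add,
    toSimple_single] at this
  exact this

section Sl2Triple

variable {M : Type v} [AddCommGroup M] [Module K M]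

theorem exists_pow_eq_zero_of_weight [FiniteDimensional K M] [CharZero K]
    {h f : Module.End K M} (hf : h * f = f * h - (2 : K) • f) :
    ∃ j, f ^ j = 0 := by
  by_contra! hne
  -- The powers of `f` are eigenvectors of `ad h` with different eigenvalues.
  let D : Module.End K (Module.End K M) := LinearMap.mulLeft K h - LinearMap.mulRight K h
  have hli : LinearIndependent K fun j : ℕ ↦ f ^ j := by
    refine Module.End.eigenvectors_linearIndependent' D (fun j : ℕ ↦ -(2 * j : K)) ?_ _ ?_
    · intro i j hij
      simpa using hij
    · intro j
      refine ⟨?_, hne j⟩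
      rw [Module.End.mem_eigenspace_iff]
      change h * f ^ j - f ^ j * h = _
      rw [mul_pow_of_sl2 hf, mul_sub, mul_smul_comm, mul_one]
      module
  have := hli.finite
  exact not_finite ℕ

theorem H_pow_Xm_of_primitive {h f : Module.End K M} (hf : h * f = f * h - (2 : K) • f)
    {μ : K} {v : M} (hhv : h v = μ • v) (i : ℕ) :
    h ((f ^ i) v) = (μ - 2 * i) • (f ^ i) v := by
  have h1 := LinearMap.congr_fun (mul_pow_of_sl2 hf i) v
  simp only [Module.End.mul_apply, LinearMap.sub_apply, LinearMap.smul_apply,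
    Module.End.one_apply, hhv, ← sub_smul, map_smul] at h1
  exact h1

theorem Xp_pow_Xm_of_primitive {h e f : Module.End K M} (hf : h * f = f * h - (2 : K) • f)
    (hef : e * f = f * e + h) {μ : K} {v : M} (hev : e v = 0) (hhv : h v = μ • v) (i : ℕ) :
    e ((f ^ (i + 1)) v) = (((i : K) + 1) * (μ - i)) • (f ^ i) v := by
  have h1 := LinearMap.congr_fun (mul_pow_succ_of_sl2 hf hef i) v
  simp only [LinearMap.sub_apply, LinearMap.add_apply, Module.End.mul_apply,
    LinearMap.smul_apply, hev, hhv, map_zero, map_smul, zero_add, smul_smul] at h1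
  rw [h1, ← sub_smul, ← mul_sub]

/-- A nonzero finite-dimensional representation of `sl₂` contains a vector which is primitive of
weight `N ∈ ℕ` and generates a subrepresentation of dimension `N + 1`. No eigenvalue has to be
assumed in the field: if `k` is the greatest integer such that `eᵏ ≠ 0`, then `h eᵏ = k eᵏ`. -/
theorem exists_primitive_vector [FiniteDimensional K M] [CharZero K] [Nontrivial M]
    {h e f : Module.End K M}
    (he : h * e = e * h + (2 : K) • e) (hf : h * f = f * h - (2 : K) • f)
    (hef : e * f = f * e + h) :
    ∃ (N : ℕ) (v : M), e v = 0 ∧ h v = (N : K) • v ∧ (f ^ (N + 1)) v = 0 ∧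
      LinearIndependent K fun i : Fin (N + 1) ↦ (f ^ (i : ℕ)) v := by
  have he' : -h * e = e * -h - (2 : K) • e := by
    rw [neg_mul, he, mul_neg]
    abel
  obtain ⟨k, hk, hk1⟩ := Nat.exists_not_and_succ_of_not_zero_of_exists
    (p := fun j ↦ e ^ j = 0) (by simp) (exists_pow_eq_zero_of_weight he')
  have hek : h * e ^ k = (k : K) • e ^ k := by
    have h1 := mul_pow_succ_of_sl2 he' (by rw [hef]; abel : f * e = e * f + -h) k
    have h2 := mul_pow_of_sl2 he' k
    have h3 : ((k : K) + 1) • (e ^ k * h + (k : K) • e ^ k) = 0 := by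
      have : ((k : K) + 1) • (e ^ k * h + (k : K) • e ^ k) =
        -(((k : K) + 1) • (e ^ k * -h) - (((k : K) + 1) * k) • e ^ k) := by
        rw [mul_neg]
        module
      rw [this, neg_eq_zero]
      rw [hk1] at h1
      simpa using h1.symm
    have h4 := (smul_eq_zero.mp h3).resolve_left (Nat.cast_add_one_ne_zero k)
    rw [neg_mul, mul_sub, mul_neg, mul_smul_comm, mul_one, neg_eq_iff_eq_neg] at h2
    rw [h2, eq_neg_of_add_eq_zero_left h4]
    module
  obtain ⟨w, hw⟩ : ∃ w, (e ^ k) w ≠ 0 := by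
    by_contra! hall
    exact hk (LinearMap.ext hall)
  let v := (e ^ k) w
  have hev : e v = 0 := by
    change (e * e ^ k) w = 0
    rw [← pow_succ', hk1, LinearMap.zero_apply]
  have hhv : h v = (k : K) • v := by
    change (h * e ^ k) w = _
    rw [hek]
    rfl
  have hfv : ∃ j, (f ^ j) v = 0 := by
    obtain ⟨j, hj⟩ := exists_pow_eq_zero_of_weight hf
    exact ⟨j, by rw [hj, LinearMap.zero_apply]⟩
  obtain ⟨N, hN, hN1⟩ := Nat.exists_not_and_succ_of_not_zero_of_exists
    (p := fun j ↦ (f ^ j) v = 0) (by simpa using hw) hfv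
  have hNk : k = N := by
    have h1 := Xp_pow_Xm_of_primitive hf hef hev hhv N
    rw [hN1, map_zero, eq_comm, smul_eq_zero] at h1
    have h2 := (mul_eq_zero.mp (h1.resolve_right hN)).resolve_left (Nat.cast_add_one_ne_zero N)
    exact_mod_cast sub_eq_zero.mp h2
  subst hNk
  refine ⟨k, v, hev, hhv, hN1, ?_⟩
  refine Module.End.eigenvectors_linearIndependent' h
    (fun i : Fin (k + 1) ↦ ((k : K) - 2 * (i : ℕ))) ?_ _ ?_
  · intro i j hij
    simpa [Fin.ext_iff] using hij
  · intro i
    refine ⟨?_, fun h0 ↦ hN ?_⟩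
    · rw [Module.End.mem_eigenspace_iff]
      exact H_pow_Xm_of_primitive hf hhv i
    · have hi : k = (k - i) + i := by omega
      rw [hi, pow_add, Module.End.mul_apply, h0, map_zero]

/-- The homomorphism from the Verma module of highest weight `N` to a representation of `U(sl₂)`,
`b_i ↦ (X⁻)ⁱ v`, for a primitive vector `v` of weight `N`. -/
theorem map_classicalAction_of_primitive (τ : Usl2 K →ₐ[K] Module.End K M) {N : ℕ} {v : M}
    (hev : τ (genUsl2 K Gen.Xp) v = 0) (hhv : τ (genUsl2 K Gen.H) v = (N : K) • v)
    (x : Usl2 K) (w : VermaSpace K) :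
    Finsupp.linearCombination K (fun i ↦ (τ (genUsl2 K Gen.Xm) ^ i) v)
        (classicalAction K N x w) =
      τ x (Finsupp.linearCombination K (fun i ↦ (τ (genUsl2 K Gen.Xm) ^ i) v) w) := by
  have hf := congrArg τ (genUsl2_H_mul_Xm (K := K))
  rw [map_sub, map_mul, map_mul, map_smul] at hf
  have hef := congrArg τ (genUsl2_Xp_mul_Xm (K := K))
  rw [map_add, map_mul, map_mul] at hef
  set θ := Finsupp.linearCombination K fun i ↦ (τ (genUsl2 K Gen.Xm) ^ i) v with hθdef
  have hθ : ∀ i, θ (Finsupp.single i 1) = (τ (genUsl2 K Gen.Xm) ^ i) v := fun i ↦ by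
    rw [hθdef, Finsupp.linearCombination_single, one_smul]
  have hx : x ∈ Algebra.adjoin K (Set.range (genUsl2 K)) := by simp [adjoin_genUsl2]
  induction hx using Algebra.adjoin_induction generalizing w with
  | mem y hy =>
    obtain ⟨g, rfl⟩ := hy
    rw [classicalAction_gen]
    suffices h : θ ∘ₗ classicalGen K N g = τ (genUsl2 K g) ∘ₗ θ from LinearMap.congr_fun h w
    refine Finsupp.lhom_ext' fun i ↦ LinearMap.ext_ring ?_
    change θ (classicalGen K N g (Finsupp.single i 1)) =
      τ (genUsl2 K g) (θ (Finsupp.single i 1))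
    rw [hθ]
    cases g with
    | H =>
      rw [classicalGen_H, map_smul, hθ, Int.cast_natCast, H_pow_Xm_of_primitive hf hhv]
    | Xm =>
      rw [classicalGen_Xm, hθ, pow_succ', Module.End.mul_apply]
    | Xp =>
      cases i with
      | zero => rw [classicalGen_Xp_zero, map_zero, pow_zero, Module.End.one_apply, hev]
      | succ i =>
        rw [classicalGen_Xp_succ, map_smul, hθ, Int.cast_natCast,
          Xp_pow_Xm_of_primitive hf hef hev hhv]
  | algebraMap r =>
    rw [AlgHom.commutes, AlgHom.commutes, Module.algebraMap_end_apply,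
      Module.algebraMap_end_apply, map_smul]
  | add y z _ _ hy hz =>
    rw [map_add, map_add, LinearMap.add_apply, LinearMap.add_apply, map_add, hy, hz]
  | mul y z _ _ hy hz =>
    rw [map_mul, map_mul, Module.End.mul_apply, Module.End.mul_apply, hy, hz]

/-- An element of `U(sl₂)` that acts by zero on some simple module of dimension `n + 1` acts by
zero on the simple quotient of the Verma module of highest weight `n`: the module is isomorphic
to this quotient. -/
theorem classicalAction_apply_eq_zero_of_simple [FiniteDimensional K M] [CharZero K]
    [Nontrivial M] (τ : Usl2 K →ₐ[K] Module.End K M)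
    (hsimple : ∀ S : Submodule K M, (∀ x, ∀ v ∈ S, τ x v ∈ S) → S ≠ ⊥ → S = ⊤) {n : ℕ}
    (hn : Module.finrank K M = n + 1) {x : Usl2 K} (hx : τ x = 0) (j a : ℕ) (ha : a ≤ n) :
    classicalAction K n x (Finsupp.single j 1) a = 0 := by
  have he := congrArg τ (genUsl2_Xp_mul_H (K := K))
  rw [sub_mul, map_sub, map_mul, map_mul, smul_mul_assoc, one_mul, map_smul,
    eq_sub_iff_add_eq, eq_comm] at he
  have hf := congrArg τ (genUsl2_H_mul_Xm (K := K))
  rw [map_sub, map_mul, map_mul, map_smul] at hf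
  have hef := congrArg τ (genUsl2_Xp_mul_Xm (K := K))
  rw [map_add, map_mul, map_mul] at hef
  obtain ⟨N, v, hev, hhv, hfv, hli⟩ := exists_primitive_vector he hf hef
  have hcomm := map_classicalAction_of_primitive τ hev hhv
  set θ := Finsupp.linearCombination K fun i ↦ (τ (genUsl2 K Gen.Xm) ^ i) v with hθdef
  have hθsum : ∀ w, θ w = ∑ i : Fin (N + 1), w i • (τ (genUsl2 K Gen.Xm) ^ (i : ℕ)) v := by
    intro w
    have hz : ∀ i ∉ Finset.range (N + 1), w i • (τ (genUsl2 K Gen.Xm) ^ i) v = 0 := by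
      intro i hi
      rw [Finset.mem_range] at hi
      have : i = (i - (N + 1)) + (N + 1) := by omega
      rw [this, pow_add, Module.End.mul_apply, hfv, map_zero, smul_zero]
    rw [Fin.sum_univ_eq_sum_range (fun i ↦ w i • (τ (genUsl2 K Gen.Xm) ^ i) v), hθdef,
      Finsupp.linearCombination_apply, Finsupp.sum]
    refine (Finset.sum_subset Finset.subset_union_left fun i _ hi ↦ ?_).trans
      (Finset.sum_subset (Finset.subset_union_right (s₁ := w.support)) fun i _ hi ↦ hz i hi).symm
    rw [Finsupp.notMem_support_iff.mp hi, zero_smul]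
  -- By simplicity, the homomorphism `θ` is surjective, so that `N = n`.
  have htop : LinearMap.range θ = ⊤ := by
    refine hsimple _ ?_ ?_
    · rintro y _ ⟨w, rfl⟩
      exact ⟨_, hcomm y w⟩
    · intro h0
      have h1 : θ (Finsupp.single 0 1) = 0 := by
        rw [← Submodule.mem_bot K, ← h0]
        exact ⟨_, rfl⟩
      rw [hθdef, Finsupp.linearCombination_single, one_smul] at h1
      exact hli.ne_zero 0 h1
  have hNn : N = n := by
    have hspan : Submodule.span K
        (Set.range fun i : Fin (N + 1) ↦ (τ (genUsl2 K Gen.Xm) ^ (i : ℕ)) v) = ⊤ := by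
      rw [eq_top_iff, ← htop]
      rintro _ ⟨w, rfl⟩
      rw [hθsum]
      exact Submodule.sum_mem _ fun i _ ↦
        Submodule.smul_mem _ _ (Submodule.subset_span ⟨i, rfl⟩)
    have h1 := finrank_span_eq_card hli
    rw [hspan, finrank_top, hn, Fintype.card_fin] at h1
    omega
  subst hNn
  have h0 := hcomm x (Finsupp.single j 1)
  rw [hx, LinearMap.zero_apply, hθsum] at h0
  exact Fintype.linearIndependent_iff.mp hli
    (fun i ↦ classicalAction K N x (Finsupp.single j 1) (i : ℕ)) h0 ⟨a, by omega⟩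

end Sl2Triple

/-- A surjective endomorphism `φ` of `U(sl₂)` is injective: the twist by `φ` of the simple module
of dimension `n + 1` is again simple of dimension `n + 1`, hence isomorphic to it, so that an
element of the kernel of `φ` annihilates the simple module. -/
theorem injective_of_surjective_endomorphism [CharZero K] (φ : Usl2 K →ₐ[K] Usl2 K)
    (hφ : Function.Surjective φ) : Function.Injective φ := by
  rw [injective_iff_map_eq_zero]
  intro x hx
  apply eq_zero_of_classicalAction_eq_zero
  intro n j a _ ha
  refine classicalAction_apply_eq_zero_of_simple ((simpleAction K n).comp φ) ?_
    (by rw [Module.finrank_finsupp_self, Fintype.card_fin]) ?_ j a ha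
  · intro S hS hne
    refine simpleAction_simple n S ?_ hne
    intro y w hw
    obtain ⟨y, rfl⟩ := hφ y
    exact hS y w hw
  · rw [AlgHom.comp_apply, hx, map_zero]

/-! ### The canonical surjection from `U_h(ψ) / h U_h(ψ)` to `U(sl₂)` -/

/-- The projection `U_h(a) → U(a) → U(sl₂)`, where the first map is the reduction modulo `h`. -/
def UhaToUsl2 (K : Type u) [Field K] : Uha K →ₐ[K] Usl2 K where
  toRingHom := (UaToUsl2 K : Ua K →+* Usl2 K).comp constantCoeff
  commutes' r := by
    change UaToUsl2 K (constantCoeff (algebraMap K (Uha K) r)) = _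
    rw [PowerSeries.algebraMap_apply, constantCoeff_C, AlgHom.commutes]

theorem UhaToUsl2_apply (x : Uha K) : UhaToUsl2 K x = UaToUsl2 K (constantCoeff x) := rfl

theorem UhaToUsl2_eq_zero_of_mem_Ih [CharZero K] {ψ : Colouring K} {x : Uha K} (hx : x ∈ Ih ψ) :
    UhaToUsl2 K x = 0 := by
  apply eq_zero_of_classicalAction_eq_zero
  intro n j a _ _
  rw [UhaToUsl2_apply, ← constantCoeff_uaAction ψ]
  have h := congrArg (coeff 0) (mem_Ih.mp hx n)
  rw [uhaAction, coeff_extend] at h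
  simp only [Finset.Nat.antidiagonal_zero, Finset.sum_singleton, coeff_zero_eq_constantCoeff,
    map_zero] at h
  rw [h]
  rfl

/-- The canonical homomorphism `U_h(ψ) / h U_h(ψ) → U(sl₂)`. It exists since the elements of
`I_h(ψ)` act by zero on the classical Verma modules modulo `h`. -/
def UhModToUsl2 [CharZero K] (ψ : Colouring K) : Uh ψ ⧸ hIdeal K (Uh ψ) →ₐ[K] Usl2 K :=
  Ideal.Quotient.liftₐ _
    (Ideal.Quotient.liftₐ (Ih ψ) (UhaToUsl2 K) fun _ ↦ UhaToUsl2_eq_zero_of_mem_Ih)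
    (by
      rintro _ ⟨y, rfl⟩
      obtain ⟨x, rfl⟩ := Ideal.Quotient.mk_surjective y
      change UhaToUsl2 K ((X : K⟦X⟧) • x) = 0
      rw [seriesAlgebra_X_smul, UhaToUsl2_apply, map_mul, constantCoeff_X, zero_mul, map_zero])

/-- The canonical homomorphism `U(a) → U_h(ψ) / h U_h(ψ)`. -/
def UaToUhMod (ψ : Colouring K) : Ua K →ₐ[K] Uh ψ ⧸ hIdeal K (Uh ψ) where
  toRingHom := (Ideal.Quotient.mk (hIdeal K (Uh ψ))).comp ((Ideal.Quotient.mk (Ih ψ)).comp C)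
  commutes' r := by
    change Ideal.Quotient.mk _ (Ideal.Quotient.mk _ (C (algebraMap K (Ua K) r))) = _
    rw [← PowerSeries.algebraMap_apply]
    rfl

theorem UaToUhMod_apply (ψ : Colouring K) (b : Ua K) :
    UaToUhMod ψ b = Ideal.Quotient.mk _ (Ideal.Quotient.mk _ (C b)) := rfl

theorem UhModToUsl2_UaToUhMod [CharZero K] (ψ : Colouring K) (b : Ua K) :
    UhModToUsl2 ψ (UaToUhMod ψ b) = UaToUsl2 K b := by
  change UhaToUsl2 K (C b) = _
  rw [UhaToUsl2_apply, constantCoeff_C]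

theorem UhModToUsl2_surjective [CharZero K] (ψ : Colouring K) :
    Function.Surjective (UhModToUsl2 ψ) := fun y ↦ by
  obtain ⟨b, rfl⟩ := UaToUsl2_surjective y
  exact ⟨_, UhModToUsl2_UaToUhMod ψ b⟩

theorem mk_mk_eq_zero_iff {ψ : Colouring K} {x : Uha K} :
    Ideal.Quotient.mk (hIdeal K (Uh ψ)) (Ideal.Quotient.mk (Ih ψ) x) = 0 ↔
      ∃ y, x - X * y ∈ Ih ψ := by
  rw [Ideal.Quotient.eq_zero_iff_mem]
  constructor
  · rintro ⟨y, hy⟩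
    obtain ⟨y, rfl⟩ := Ideal.Quotient.mk_surjective y
    refine ⟨y, ?_⟩
    rw [← Ideal.Quotient.eq, hy, ← seriesAlgebra_X_smul (K := K)]
    rfl
  · rintro ⟨y, hy⟩
    refine ⟨Ideal.Quotient.mk _ y, ?_⟩
    rw [← Ideal.Quotient.eq, ← seriesAlgebra_X_smul (K := K)] at hy
    rw [hy]
    rfl

theorem UaToUhMod_surjective (ψ : Colouring K) : Function.Surjective (UaToUhMod ψ) := fun y ↦ by
  obtain ⟨y, rfl⟩ := Ideal.Quotient.mk_surjective y
  obtain ⟨x, rfl⟩ := Ideal.Quotient.mk_surjective y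
  refine ⟨constantCoeff x, ?_⟩
  rw [UaToUhMod_apply, eq_comm, ← sub_eq_zero, ← map_sub, ← map_sub, mk_mk_eq_zero_iff]
  refine ⟨PowerSeries.mk fun p ↦ coeff (p + 1) x, ?_⟩
  rw [sub_sub, add_comm, ← eq_X_mul_shift_add_const, sub_self]
  exact zero_mem _

/-- The element `X⁺ X⁻ - X⁻ X⁺ - H` of `U(a)`, which generates the kernel of `U(a) → U(sl₂)`. -/
def sl2Relator (K : Type u) [Field K] : Ua K :=
  genUa K Gen.Xp * genUa K Gen.Xm - genUa K Gen.Xm * genUa K Gen.Xp - genUa K Gen.H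

theorem UaToUsl2_sl2Relator : UaToUsl2 K (sl2Relator K) = 0 := by
  rw [sl2Relator]
  simp only [map_sub, map_mul, UaToUsl2_genUa]
  rw [← Ring.lie_def, genUsl2_rel_H, sub_self]

theorem isFormalDeformationOver_of_bijective [CharZero K] {ψ : Colouring K}
    (h : Function.Bijective (UhModToUsl2 ψ)) :
    IsFormalDeformationOver K (UaToUsl2 K) (Ideal.Quotient.mkₐ K⟦X⟧ (Ih ψ)) :=
  ⟨topologicallyFree_Uh ψ, AlgEquiv.ofBijective _ h, UhModToUsl2_UaToUhMod ψ⟩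

theorem isFormalDeformationOver_iff [CharZero K] {ψ : Colouring K} :
    IsFormalDeformationOver K (UaToUsl2 K) (Ideal.Quotient.mkₐ K⟦X⟧ (Ih ψ)) ↔
      ∃ y, C (sl2Relator K) - X * y ∈ Ih ψ := by
  constructor
  · rintro ⟨_, e, he⟩
    rw [← mk_mk_eq_zero_iff]
    apply e.injective
    rw [map_zero]
    exact (he _).trans UaToUsl2_sl2Relator
  · intro h
    rw [← mk_mk_eq_zero_iff, ← UaToUhMod_apply, sl2Relator, map_sub, map_sub, map_mul, map_mul,
      sub_eq_zero, ← Ring.lie_def] at h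
    have hp := congrArg (UaToUhMod ψ) (genUa_rel_Xp (K := K))
    have hm := congrArg (UaToUhMod ψ) (genUa_rel_Xm (K := K))
    rw [Ring.lie_def, map_sub, map_mul, map_mul, ← Ring.lie_def, map_smul] at hp
    rw [Ring.lie_def, map_sub, map_mul, map_mul, ← Ring.lie_def, map_neg, map_smul] at hm
    let s : Usl2 K →ₐ[K] Uh ψ ⧸ hIdeal K (Uh ψ) := UniversalEnvelopingAlgebra.lift K
      (liftSl2 (fun g ↦ UaToUhMod ψ (genUa K g)) hp hm h)
    have hs : s.comp (UaToUsl2 K) = UaToUhMod ψ := by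
      refine hom_ext_ua fun g ↦ ?_
      rw [AlgHom.comp_apply, UaToUsl2_genUa, genUsl2, UniversalEnvelopingAlgebra.lift_ι_apply,
        liftSl2_genSl2]
    refine isFormalDeformationOver_of_bijective ⟨?_, UhModToUsl2_surjective ψ⟩
    refine Function.LeftInverse.injective (g := s) fun y ↦ ?_
    obtain ⟨b, rfl⟩ := UaToUhMod_surjective ψ y
    rw [UhModToUsl2_UaToUhMod]
    exact AlgHom.congr_fun hs b

theorem isFormalDeformationOver_of_isFormalDeformation [CharZero K] {ψ : Colouring K}
    (h : IsFormalDeformation K (Usl2 K) (Uh ψ)) :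
    IsFormalDeformationOver K (UaToUsl2 K) (Ideal.Quotient.mkₐ K⟦X⟧ (Ih ψ)) := by
  obtain ⟨_, ⟨e⟩⟩ := h
  refine isFormalDeformationOver_of_bijective ⟨?_, UhModToUsl2_surjective ψ⟩
  have hsurj : Function.Surjective ((UhModToUsl2 ψ).comp e.toAlgHom) :=
    (UhModToUsl2_surjective ψ).comp e.surjective
  have hinj := injective_of_surjective_endomorphism _ hsurj
  intro x y hxy
  obtain ⟨x, rfl⟩ := e.surjective x
  obtain ⟨y, rfl⟩ := e.surjective y
  exact congrArg e (hinj hxy)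

/-! ### Matrix coefficients of the action of `U(a)` -/

/-- The coefficient of `hᵐ` in `ψᵏ(n)`, with the convention `ψ⁰(n) = 0`. -/
def Colouring.valCoeff (ψ : Colouring K) (m k : ℕ) (n : ℤ) : K :=
  if k = 0 then 0 else coeff m (ψ.val k n)

theorem Colouring.valCoeff_zero (ψ : Colouring K) (m : ℕ) (n : ℤ) : ψ.valCoeff m 0 n = 0 :=
  if_pos rfl

theorem Colouring.valCoeff_of_pos (ψ : Colouring K) (m : ℕ) {k : ℕ} (hk : 1 ≤ k) (n : ℤ) :
    ψ.valCoeff m k n = coeff m (ψ.val k n) :=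
  if_neg (by omega)

theorem coeff_genAction_Xp_zero (ψ : Colouring K) (n : ℤ) (m : ℕ) :
    coeff m (genAction ψ n Gen.Xp) (Finsupp.single 0 1) = 0 := by
  rw [genAction, coeff_mk]
  refine (Finsupp.linearCombination_single K _ _).trans ?_
  rw [one_smul]

theorem coeff_genAction_Xp_succ (ψ : Colouring K) (n : ℤ) (m k : ℕ) :
    coeff m (genAction ψ n Gen.Xp) (Finsupp.single (k + 1) 1) =
      ψ.valCoeff m (k + 1) n • Finsupp.single k 1 := by
  rw [genAction, coeff_mk, ψ.valCoeff_of_pos m (by omega)]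
  refine (Finsupp.linearCombination_single K _ _).trans ?_
  rw [one_smul]

theorem coeff_mul_genAction_H (ψ : Colouring K) (n : ℤ) (m j : ℕ)
    (f : (Module.End K (VermaSpace K))⟦X⟧) :
    coeff m (f * genAction ψ n Gen.H) (Finsupp.single j 1) =
      ((n : K) - 2 * (j : K)) • coeff m f (Finsupp.single j 1) := by
  rw [genAction, coeff_mul_C, Module.End.mul_apply, Finsupp.linearCombination_single, one_smul,
    map_smul]

theorem coeff_mul_genAction_Xm (ψ : Colouring K) (n : ℤ) (m j : ℕ)
    (f : (Module.End K (VermaSpace K))⟦X⟧) :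
    coeff m (f * genAction ψ n Gen.Xm) (Finsupp.single j 1) =
      coeff m f (Finsupp.single (j + 1) 1) := by
  rw [genAction, coeff_mul_C, Module.End.mul_apply, Finsupp.linearCombination_single, one_smul]

theorem coeff_genAction_H (ψ : Colouring K) (n : ℤ) (m j : ℕ) :
    coeff m (genAction ψ n Gen.H) (Finsupp.single j 1) =
      (if m = 0 then (n : K) - 2 * (j : K) else 0) • Finsupp.single j 1 := by
  rw [← one_mul (genAction ψ n Gen.H), coeff_mul_genAction_H, coeff_one]
  split_ifs <;> simp

theorem coeff_genAction_Xm_mul (ψ : Colouring K) (n : ℤ) (m j : ℕ)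
    (f : (Module.End K (VermaSpace K))⟦X⟧) :
    coeff m (genAction ψ n Gen.Xm * f) (Finsupp.single j 1) =
      coeff 0 (genAction ψ n Gen.Xm) (coeff m f (Finsupp.single j 1)) := by
  rw [genAction, coeff_C_mul, coeff_zero_C, Module.End.mul_apply]

/-- `X⁺ X⁻` acts on `b_j` by `ψʲ⁺¹(n)`. -/
theorem coeff_genAction_Xp_mul_Xm (ψ : Colouring K) (n : ℤ) (m j : ℕ) :
    coeff m (genAction ψ n Gen.Xp * genAction ψ n Gen.Xm) (Finsupp.single j 1) =
      ψ.valCoeff m (j + 1) n • Finsupp.single j 1 := by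
  rw [coeff_mul_genAction_Xm, coeff_genAction_Xp_succ]

/-- `X⁻ X⁺` acts on `b_j` by `ψʲ(n)`. -/
theorem coeff_genAction_Xm_mul_Xp (ψ : Colouring K) (n : ℤ) (m j : ℕ) :
    coeff m (genAction ψ n Gen.Xm * genAction ψ n Gen.Xp) (Finsupp.single j 1) =
      ψ.valCoeff m j n • Finsupp.single j 1 := by
  rw [coeff_genAction_Xm_mul]
  cases j with
  | zero => rw [coeff_genAction_Xp_zero, map_zero, ψ.valCoeff_zero, zero_smul]
  | succ j =>
    rw [coeff_genAction_Xp_succ, map_smul, genAction, coeff_zero_C,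
      Finsupp.linearCombination_single, one_smul]

theorem coeff_sl2Relator (ψ : Colouring K) (n : ℤ) (m j : ℕ) :
    coeff m (uaAction ψ n (sl2Relator K)) (Finsupp.single j 1) =
      (ψ.valCoeff m (j + 1) n - ψ.valCoeff m j n -
        if m = 0 then (n : K) - 2 * (j : K) else 0) • Finsupp.single j 1 := by
  simp only [sl2Relator, map_mul, uaAction_genUa, map_sub, LinearMap.sub_apply]
  rw [coeff_genAction_Xp_mul_Xm, coeff_genAction_Xm_mul_Xp, coeff_genAction_H, sub_smul, sub_smul]

/-! ### From the relation of `sl₂` modulo `h` to the regularity of the colouring -/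

/-- The value at `(k, n)` of a polynomial in two variables. -/
abbrev evalAt (k : ℕ) (n : ℤ) : MvPolynomial (Fin 2) K →+* K :=
  MvPolynomial.eval ![(k : K), (n : K)]

/-- The substitution `k ↦ k + c`. -/
def shiftVar (c : K) : MvPolynomial (Fin 2) K →ₐ[K] MvPolynomial (Fin 2) K :=
  MvPolynomial.aeval ![MvPolynomial.X 0 + MvPolynomial.C c, MvPolynomial.X 1]

theorem eval_shiftVar (c x y : K) (Q : MvPolynomial (Fin 2) K) :
    MvPolynomial.eval ![x, y] (shiftVar c Q) = MvPolynomial.eval ![x + c, y] Q := by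
  induction Q using MvPolynomial.induction_on with
  | C a => rw [shiftVar, MvPolynomial.algHom_C, MvPolynomial.algebraMap_eq, MvPolynomial.eval_C,
      MvPolynomial.eval_C]
  | add p q hp hq => simp only [map_add, hp, hq]
  | mul_X p i hp =>
    rw [map_mul, map_mul, map_mul, hp]
    congr 1
    fin_cases i <;> simp [shiftVar]

/-- The sums of a polynomial over an initial segment are polynomial, by Faulhaber's formula. -/
theorem exists_polynomial_sum_range [CharZero K] (Q : MvPolynomial (Fin 2) K) :
    ∃ S : MvPolynomial (Fin 2) K, ∀ (k : ℕ) (n : ℤ),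
      ∑ j ∈ Finset.range k, evalAt j n Q = evalAt k n S := by
  induction Q using MvPolynomial.induction_on' with
  | add p q hp hq =>
    obtain ⟨S, hS⟩ := hp
    obtain ⟨T, hT⟩ := hq
    refine ⟨S + T, fun k n ↦ ?_⟩
    simp only [map_add, Finset.sum_add_distrib, hS, hT]
  | monomial s a =>
    let p := s 0
    refine ⟨MvPolynomial.C a * (∑ i ∈ Finset.range (p + 1), MvPolynomial.C
      (((bernoulli i * ((p + 1).choose i) / (p + 1) : ℚ)) : K) * MvPolynomial.X 0 ^ (p + 1 - i)) *
        MvPolynomial.X 1 ^ (s 1), fun k n ↦ ?_⟩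
    have h := congrArg (fun q : ℚ ↦ (q : K)) (sum_range_pow k p)
    push_cast at h
    simp only [MvPolynomial.eval_monomial, Finsupp.prod_fintype, Fin.prod_univ_two, map_mul,
      map_sum, map_pow, MvPolynomial.eval_C, MvPolynomial.eval_X, Matrix.cons_val_zero,
      Matrix.cons_val_one, pow_zero, implies_true, ← mul_assoc, ← Finset.sum_mul, ← Finset.mul_sum]
    congr 2
    refine h.trans (Finset.sum_congr rfl fun i _ ↦ ?_)
    push_cast
    ring

/-- The property that the matrix coefficients of the action of `x` on the deformed Verma modules
are, modulo `hᵐ⁺¹` and on each diagonal, polynomial functions of `(j, n)`. -/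
def HasPolynomialCoeffs (ψ : Colouring K) (m : ℕ) (x : Ua K) : Prop :=
  ∀ i ≤ m, ∀ d : ℤ, ∃ Q : MvPolynomial (Fin 2) K, ∀ (j t : ℕ) (n : ℤ), (t : ℤ) = j + d →
    coeff i (uaAction ψ n x) (Finsupp.single j 1) t = evalAt j n Q

/-- Multiplication on the right by `X⁺`, rather than on the left, lets the convention `ψ⁰ = 0`
take care of the relation `X⁺ b_0 = 0`. -/
theorem HasPolynomialCoeffs.mul_genUa {ψ : Colouring K} {m : ℕ}
    (hψ : ∀ i ≤ m, ∃ P : MvPolynomial (Fin 2) K, ∀ k n, ψ.valCoeff i k n = evalAt k n P)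
    {x : Ua K} (hx : HasPolynomialCoeffs ψ m x) (g : Gen) :
    HasPolynomialCoeffs ψ m (x * genUa K g) := by
  intro i hi d
  simp only [map_mul, uaAction_genUa]
  cases g with
  | H =>
    obtain ⟨Q, hQ⟩ := hx i hi d
    refine ⟨(MvPolynomial.X 1 - 2 * MvPolynomial.X 0) * Q, fun j t n htj ↦ ?_⟩
    rw [coeff_mul_genAction_H, Finsupp.smul_apply, hQ j t n htj]
    simp
  | Xm =>
    obtain ⟨Q, hQ⟩ := hx i hi (d - 1)
    refine ⟨shiftVar 1 Q, fun j t n htj ↦ ?_⟩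
    rw [coeff_mul_genAction_Xm, hQ (j + 1) t n (by push_cast; omega), eval_shiftVar,
      ← Nat.cast_add_one]
  | Xp =>
    choose! P hP using hψ
    choose! Q hQ using hx
    refine ⟨∑ p ∈ Finset.HasAntidiagonal.antidiagonal i,
      P p.2 * shiftVar (-1) (Q p.1 (d + 1)), fun j t n htj ↦ ?_⟩
    rw [coeff_mul, LinearMap.sum_apply, Finsupp.finsetSum_apply, map_sum]
    refine Finset.sum_congr rfl fun p hp ↦ ?_
    have hple := Finset.HasAntidiagonal.mem_antidiagonal.mp hp
    rw [map_mul, ← hP p.2 (by omega), Module.End.mul_apply, eval_shiftVar]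
    cases j with
    | zero => rw [coeff_genAction_Xp_zero, map_zero, ψ.valCoeff_zero, zero_mul, Finsupp.zero_apply]
    | succ j =>
      rw [coeff_genAction_Xp_succ, map_smul, Finsupp.smul_apply, smul_eq_mul,
        hQ p.1 (by omega) (d + 1) j t n (by push_cast at htj; omega)]
      push_cast
      rw [add_neg_cancel_right]

theorem HasPolynomialCoeffs.one (ψ : Colouring K) (m : ℕ) : HasPolynomialCoeffs ψ m 1 := by
  intro i _ d
  refine ⟨if i = 0 ∧ d = 0 then 1 else 0, fun j t n htj ↦ ?_⟩
  rw [map_one, coeff_one]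
  by_cases hi : i = 0
  · by_cases hd : d = 0
    · have : t = j := by omega
      simp [hi, hd, this]
    · have : t ≠ j := by omega
      simp [hi, hd, this]
  · simp [hi]

theorem HasPolynomialCoeffs.add {ψ : Colouring K} {m : ℕ} {x y : Ua K}
    (hx : HasPolynomialCoeffs ψ m x) (hy : HasPolynomialCoeffs ψ m y) :
    HasPolynomialCoeffs ψ m (x + y) := by
  intro i hi d
  obtain ⟨P, hP⟩ := hx i hi d
  obtain ⟨Q, hQ⟩ := hy i hi d
  refine ⟨P + Q, fun j t n htj ↦ ?_⟩
  rw [map_add, map_add, map_add, LinearMap.add_apply, Finsupp.add_apply, hP j t n htj,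
    hQ j t n htj]

theorem HasPolynomialCoeffs.smul {ψ : Colouring K} {m : ℕ} {x : Ua K} (c : K)
    (hx : HasPolynomialCoeffs ψ m x) : HasPolynomialCoeffs ψ m (c • x) := by
  intro i hi d
  obtain ⟨P, hP⟩ := hx i hi d
  refine ⟨MvPolynomial.C c * P, fun j t n htj ↦ ?_⟩
  rw [map_smul, map_mul, MvPolynomial.eval_C, ← hP j t n htj]
  rfl

theorem hasPolynomialCoeffs {ψ : Colouring K} {m : ℕ}
    (hψ : ∀ i ≤ m, ∃ P : MvPolynomial (Fin 2) K, ∀ k n, ψ.valCoeff i k n = evalAt k n P)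
    (x : Ua K) : HasPolynomialCoeffs ψ m x := by
  suffices h : ∀ y, HasPolynomialCoeffs ψ m y → HasPolynomialCoeffs ψ m (y * x) by
    rw [← one_mul x]
    exact h 1 (.one ψ m)
  have hx : x ∈ Algebra.adjoin K (Set.range (genUa K)) := by simp [adjoin_genUa]
  induction hx using Algebra.adjoin_induction with
  | mem x hx =>
    obtain ⟨g, rfl⟩ := hx
    exact fun y hy ↦ hy.mul_genUa hψ g
  | algebraMap r =>
    intro y hy
    rw [← Algebra.commutes, ← Algebra.smul_def]
    exact hy.smul r
  | add x z _ _ hx hz =>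
    intro y hy
    rw [mul_add]
    exact (hx y hy).add (hz y hy)
  | mul x z _ _ hx hz =>
    intro y hy
    rw [← mul_assoc]
    exact hz _ (hx y hy)

/-- If `X⁺ X⁻ - X⁻ X⁺ - H` equals `h y` on the deformed Verma modules, then the coefficient of
`hᵐ⁺¹` in `ψʲ⁺¹(n) - ψʲ(n)` is a matrix coefficient of `y` modulo `hᵐ⁺¹`, hence is polynomial by
induction on `m`, and it remains to sum over `j`. -/
theorem exists_polynomial_valCoeff [CharZero K] {ψ : Colouring K} {y : Uha K}
    (hy : C (sl2Relator K) - X * y ∈ Ih ψ) (m : ℕ) :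
    ∃ P : MvPolynomial (Fin 2) K, ∀ k n, ψ.valCoeff m k n = evalAt k n P := by
  induction m using Nat.strong_induction_on with
  | _ m ih =>
  cases m with
  | zero =>
    refine ⟨MvPolynomial.X 0 * (MvPolynomial.X 1 - MvPolynomial.X 0 + 1), fun k n ↦ ?_⟩
    rcases Nat.eq_zero_or_pos k with rfl | hk
    · simp [ψ.valCoeff_zero]
    · rw [ψ.valCoeff_of_pos 0 hk, coeff_zero_eq_constantCoeff_apply, ψ.constantCoeff_val k hk]
      simp
  | succ m =>
    have hpol := fun b ↦ hasPolynomialCoeffs (ψ := ψ) (m := m) (fun i hi ↦ ih i (by omega)) b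
    choose! Q hQ using hpol
    let R : MvPolynomial (Fin 2) K := ∑ p ∈ Finset.HasAntidiagonal.antidiagonal m,
      Q (coeff p.1 y) p.2 0
    have hdiff : ∀ (j : ℕ) (n : ℤ),
        ψ.valCoeff (m + 1) (j + 1) n - ψ.valCoeff (m + 1) j n = evalAt j n R := by
      intro j n
      have h1 := congrArg (fun f : (Module.End K (VermaSpace K))⟦X⟧ ↦
        coeff (m + 1) f (Finsupp.single j 1) j) (mem_Ih.mp hy n)
      simp only [map_sub, uhaAction_C] at h1
      rw [← seriesAlgebra_X_smul (K := K), map_smul, seriesAlgebra_X_smul, coeff_succ_X_mul,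
        LinearMap.sub_apply, Finsupp.sub_apply, coeff_sl2Relator, if_neg (by omega), sub_zero,
        uhaAction, coeff_extend, LinearMap.sum_apply, Finsupp.finsetSum_apply] at h1
      rw [map_sum]
      have h2 : ∀ p ∈ Finset.HasAntidiagonal.antidiagonal m,
          coeff p.2 (uaAction ψ n (coeff p.1 y)) (Finsupp.single j 1) j =
            evalAt j n (Q (coeff p.1 y) p.2 0) := fun p hp ↦
        hQ _ _ (by have := Finset.HasAntidiagonal.mem_antidiagonal.mp hp; omega) 0 j j n (by simp)
      rw [Finset.sum_congr rfl h2] at h1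
      simpa [sub_eq_zero] using h1
    obtain ⟨S, hS⟩ := exists_polynomial_sum_range R
    refine ⟨S, fun k n ↦ ?_⟩
    rw [← hS, ← sub_zero (ψ.valCoeff (m + 1) k n), ← ψ.valCoeff_zero (m + 1) n,
      ← Finset.sum_range_sub (fun j ↦ ψ.valCoeff (m + 1) j n)]
    exact Finset.sum_congr rfl fun j _ ↦ hdiff j n

theorem isRegular_of_sl2Relator [CharZero K] {ψ : Colouring K} {y : Uha K}
    (hy : C (sl2Relator K) - X * y ∈ Ih ψ) : ψ.IsRegular := by
  choose P hP using exists_polynomial_valCoeff hy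
  refine ⟨PowerSeries.mk P, fun k hk n ↦ ?_⟩
  ext m
  rw [coeff_map, coeff_mk, ← ψ.valCoeff_of_pos m hk, hP]

/-! ### Polynomials invariant under the reflection of weights -/

/-- The involution of `K[k, n]` induced by `(k, n) ↦ (k - n - 1, -n - 2)`, which preserves the
weight `n - 2k`. -/
def reflectVar (K : Type u) [Field K] : MvPolynomial (Fin 2) K →ₐ[K] MvPolynomial (Fin 2) K :=
  MvPolynomial.aeval
    ![MvPolynomial.X 0 - MvPolynomial.X 1 - 1, -MvPolynomial.X 1 - 2]

theorem reflectVar_X_zero : reflectVar K (MvPolynomial.X 0) =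
    MvPolynomial.X 0 - MvPolynomial.X 1 - 1 := by
  rw [reflectVar, MvPolynomial.aeval_X, Matrix.cons_val_zero]

theorem reflectVar_X_one : reflectVar K (MvPolynomial.X 1) = -MvPolynomial.X 1 - 2 := by
  rw [reflectVar, MvPolynomial.aeval_X, Matrix.cons_val_one, Matrix.cons_val_fin_one]

theorem eval_reflectVar (x y : K) (Q : MvPolynomial (Fin 2) K) :
    MvPolynomial.eval ![x, y] (reflectVar K Q) = MvPolynomial.eval ![x - y - 1, -y - 2] Q := by
  induction Q using MvPolynomial.induction_on with
  | C a => rw [reflectVar, MvPolynomial.algHom_C, MvPolynomial.algebraMap_eq,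
      MvPolynomial.eval_C, MvPolynomial.eval_C]
  | add p q hp hq => simp only [map_add, hp, hq]
  | mul_X p i hp =>
    rw [map_mul, map_mul, map_mul, hp]
    congr 1
    fin_cases i <;> simp [reflectVar]

theorem reflectVar_shiftVar (Q : MvPolynomial (Fin 2) K) :
    reflectVar K (shiftVar 1 Q) = shiftVar 1 (reflectVar K Q) := by
  suffices h : (reflectVar K).comp (shiftVar 1) = (shiftVar 1).comp (reflectVar K) from
    AlgHom.congr_fun h Q
  have hs : shiftVar (1 : K) (MvPolynomial.X 0) = MvPolynomial.X 0 + 1 := by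
    rw [shiftVar, MvPolynomial.aeval_X, Matrix.cons_val_zero, MvPolynomial.C_1]
  have hs' : shiftVar (1 : K) (MvPolynomial.X 1) = MvPolynomial.X 1 := by
    rw [shiftVar, MvPolynomial.aeval_X, Matrix.cons_val_one, Matrix.cons_val_fin_one]
  apply MvPolynomial.algHom_ext
  intro i
  fin_cases i
  · simp only [Fin.zero_eta, AlgHom.comp_apply, hs, hs', reflectVar_X_zero, map_add, map_sub,
      map_one]
    ring
  · simp only [Fin.mk_one, AlgHom.comp_apply, hs', reflectVar_X_one, map_sub, map_neg, map_ofNat]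

/-- The homomorphism `K[w, c] → K[k, n]`, `w ↦ n - 2k`, `c ↦ (n + 1)²`: the weight, and the value
of the Casimir element. -/
def weightCasimir (K : Type u) [Field K] :
    MvPolynomial (Fin 2) K →ₐ[K] MvPolynomial (Fin 2) K :=
  MvPolynomial.aeval
    ![MvPolynomial.X 1 - 2 * MvPolynomial.X 0, (MvPolynomial.X 1 + 1) ^ 2]

theorem weightCasimir_X_zero : weightCasimir K (MvPolynomial.X 0) =
    MvPolynomial.X 1 - 2 * MvPolynomial.X 0 := by
  simp [weightCasimir]

theorem weightCasimir_X_one : weightCasimir K (MvPolynomial.X 1) =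
    (MvPolynomial.X 1 + 1) ^ 2 := by
  simp [weightCasimir]

theorem reflectVar_weightCasimir (Q : MvPolynomial (Fin 2) K) :
    reflectVar K (weightCasimir K Q) = weightCasimir K Q := by
  suffices h : (reflectVar K).comp (weightCasimir K) = weightCasimir K from AlgHom.congr_fun h Q
  apply MvPolynomial.algHom_ext
  intro i
  fin_cases i
  · simp only [Fin.zero_eta, AlgHom.comp_apply, weightCasimir_X_zero, reflectVar_X_zero,
      reflectVar_X_one, map_sub, map_mul, map_ofNat]
    ring
  · simp only [Fin.mk_one, AlgHom.comp_apply, weightCasimir_X_one, reflectVar_X_one, map_add,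
      map_pow, map_one]
    ring

theorem exists_eq_weightCasimir_add [CharZero K] (p : MvPolynomial (Fin 2) K) :
    ∃ a b, p = weightCasimir K a + (MvPolynomial.X 1 + 1) * weightCasimir K b := by
  induction p using MvPolynomial.induction_on with
  | C c =>
    exact ⟨MvPolynomial.C c, 0, by
      rw [map_zero, mul_zero, add_zero, MvPolynomial.algHom_C, MvPolynomial.algebraMap_eq]⟩
  | add p q hp hq =>
    obtain ⟨a, b, hp⟩ := hp
    obtain ⟨a', b', hq⟩ := hq
    refine ⟨a + a', b + b', ?_⟩
    rw [hp, hq, map_add, map_add]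
    ring
  | mul_X p i hp =>
    obtain ⟨a, b, rfl⟩ := hp
    fin_cases i
    · refine ⟨(2 : K)⁻¹ • (MvPolynomial.X 1 * b - a - MvPolynomial.X 0 * a),
        (2 : K)⁻¹ • (a - b - MvPolynomial.X 0 * b), ?_⟩
      have h2 : ∀ x y : MvPolynomial (Fin 2) K, (2 : K) • x = (2 : K) • y → x = y :=
        fun x y h ↦ smul_right_injective _ (two_ne_zero (α := K)) h
      apply h2
      simp only [map_smul, map_sub, map_mul, weightCasimir_X_zero, weightCasimir_X_one, smul_add,
        mul_smul_comm, smul_smul, mul_inv_cancel₀ (two_ne_zero (α := K)), one_smul]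
      rw [MvPolynomial.smul_eq_C_mul, map_ofNat]
      simp only [Fin.zero_eta]
      ring
    · refine ⟨MvPolynomial.X 1 * b - a, a - b, ?_⟩
      simp only [map_sub, map_mul, weightCasimir_X_one, Fin.mk_one]
      ring

/-- The subalgebra of the invariants of the reflection. -/
def reflectInvariants (K : Type u) [Field K] : Subalgebra K (MvPolynomial (Fin 2) K) :=
  AlgHom.equalizer (reflectVar K) (AlgHom.id K _)

theorem mem_reflectInvariants {p : MvPolynomial (Fin 2) K} :
    p ∈ reflectInvariants K ↔ reflectVar K p = p := Iff.rfl

/-- The weight and the value of the Casimir element generate the invariants of the reflection,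
which changes the sign of `n + 1`. -/
theorem exists_weightCasimir_eq [CharZero K] {p : MvPolynomial (Fin 2) K}
    (hp : p ∈ reflectInvariants K) : ∃ a, weightCasimir K a = p := by
  obtain ⟨a, b, h⟩ := exists_eq_weightCasimir_add p
  refine ⟨a, ?_⟩
  rw [mem_reflectInvariants] at hp
  have h1 : reflectVar K (MvPolynomial.X 1 + 1) = -(MvPolynomial.X 1 + 1) := by
    rw [map_add, map_one, reflectVar_X_one]
    ring
  rw [h, map_add, map_mul, reflectVar_weightCasimir, reflectVar_weightCasimir, h1] at hp
  have h2 : (2 : MvPolynomial (Fin 2) K) * ((MvPolynomial.X 1 + 1) * weightCasimir K b) = 0 := by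
    linear_combination -hp
  rw [h, (mul_eq_zero.mp h2).resolve_left two_ne_zero, add_zero]

/-! ### From the regularity of the colouring to the relation of `sl₂` modulo `h` -/

theorem eval_pair_congr {x x' y y' : K} (hx : x = x') (hy : y = y') (p : MvPolynomial (Fin 2) K) :
    MvPolynomial.eval ![x, y] p = MvPolynomial.eval ![x', y'] p := by
  rw [hx, hy]

theorem infinite_range_natCast_succ [CharZero K] : (Set.range fun k : ℕ ↦ (k : K) + 1).Infinite :=
  Set.infinite_range_of_injective fun i j h ↦ by simpa using h

theorem infinite_range_neg_natCast_sub_two [CharZero K] :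
    (Set.range fun n : ℕ ↦ -(n : K) - 2).Infinite :=
  Set.infinite_range_of_injective fun i j h ↦ by simpa using h

/-- A polynomial is determined by its values at the points `(k, n)` with `k ≥ 1` and `n ≤ -2`. -/
theorem polynomial_ext_of_eval [CharZero K] {p q : MvPolynomial (Fin 2) K}
    (h : ∀ k n : ℕ, MvPolynomial.eval ![(k : K) + 1, -(n : K) - 2] p =
      MvPolynomial.eval ![(k : K) + 1, -(n : K) - 2] q) : p = q := by
  refine MvPolynomial.funext_set
    ![Set.range fun k : ℕ ↦ (k : K) + 1, Set.range fun n : ℕ ↦ -(n : K) - 2] ?_ ?_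
  · intro i
    fin_cases i
    · exact infinite_range_natCast_succ
    · exact infinite_range_neg_natCast_sub_two
  · intro x hx
    obtain ⟨k, hk⟩ := hx 0 trivial
    obtain ⟨n, hn⟩ := hx 1 trivial
    have hxe : x = ![(k : K) + 1, -(n : K) - 2] := by
      ext i
      fin_cases i
      · exact hk.symm
      · exact hn.symm
    rw [hxe]
    exact h k n

section Regular

variable [CharZero K] {ψ : Colouring K} {P : (MvPolynomial (Fin 2) K)⟦X⟧}
  (hP : ∀ k : ℕ, 1 ≤ k → ∀ n : ℤ,
    ψ.val k n = PowerSeries.map (MvPolynomial.eval ![(k : K), (n : K)]) P)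

include hP

theorem coeff_mem_reflectInvariants (m : ℕ) : coeff m P ∈ reflectInvariants K := by
  refine polynomial_ext_of_eval fun k n ↦ ?_
  rw [eval_reflectVar]
  have h := congrArg (coeff m) (ψ.val_reflect (k + 1) (by omega) n)
  rw [hP _ (by omega), hP _ (by omega), coeff_map, coeff_map] at h
  push_cast at h
  rw [AlgHom.id_apply, ← h]
  refine eval_pair_congr ?_ ?_ _ <;> ring

theorem valCoeff_eq_eval (m k : ℕ) (n : ℤ) : ψ.valCoeff m k n = evalAt k n (coeff m P) := by
  rcases Nat.eq_zero_or_pos k with rfl | hk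
  · -- By reflection, the values `ψⁿ⁺¹(n) = 0` yield the vanishing of the polynomial at `k = 0`.
    rw [ψ.valCoeff_zero]
    let z : MvPolynomial (Fin 2) K →ₐ[K] MvPolynomial (Fin 2) K :=
      MvPolynomial.aeval ![0, MvPolynomial.X 1]
    have hz : ∀ (x y : K) (Q : MvPolynomial (Fin 2) K),
        MvPolynomial.eval ![x, y] (z Q) = MvPolynomial.eval ![0, y] Q := by
      intro x y Q
      induction Q using MvPolynomial.induction_on with
      | C a => rw [MvPolynomial.algHom_C, MvPolynomial.algebraMap_eq, MvPolynomial.eval_C,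
          MvPolynomial.eval_C]
      | add p q hp hq => simp only [map_add, hp, hq]
      | mul_X p i hp =>
        rw [map_mul, map_mul, map_mul, hp]
        congr 1
        fin_cases i <;> simp [z]
    have h0 : z (coeff m P) = 0 := by
      refine polynomial_ext_of_eval fun k n ↦ ?_
      rw [hz, map_zero, ← mem_reflectInvariants.mp (coeff_mem_reflectInvariants hP m),
        eval_reflectVar]
      have h := congrArg (coeff m) (ψ.val_succ_self n)
      rw [hP _ (by omega), coeff_map, map_zero] at h
      refine Eq.trans (eval_pair_congr ?_ ?_ _) h <;> push_cast <;> ring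
    have h1 := hz 0 (n : K) (coeff m P)
    rw [h0, map_zero] at h1
    rw [h1]
    exact eval_pair_congr Nat.cast_zero.symm rfl _
  · rw [ψ.valCoeff_of_pos m hk, hP k hk, coeff_map]

theorem constantCoeff_eq_of_regular : constantCoeff P =
    MvPolynomial.X 0 * (MvPolynomial.X 1 - MvPolynomial.X 0 + 1) := by
  refine polynomial_ext_of_eval fun k n ↦ ?_
  have h := ψ.constantCoeff_val (k + 1) (by omega) (-(n : ℤ) - 2)
  rw [hP _ (by omega), ← coeff_zero_eq_constantCoeff_apply, coeff_map,
    coeff_zero_eq_constantCoeff_apply] at h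
  push_cast at h
  rw [h]
  simp

end Regular

/-- The property that `z` acts on `b_j` in `V(n, ψ)` by the value of `F` at `(j, n)`. -/
def ActsBy (ψ : Colouring K) (z : Uha K) (F : (MvPolynomial (Fin 2) K)⟦X⟧) : Prop :=
  ∀ (n : ℤ) (j m : ℕ), coeff m (uhaAction ψ n z) (Finsupp.single j 1) =
    evalAt j n (coeff m F) • Finsupp.single j 1

namespace ActsBy

variable {ψ : Colouring K} {z z' : Uha K} {F F' : (MvPolynomial (Fin 2) K)⟦X⟧}

protected theorem add (h : ActsBy ψ z F) (h' : ActsBy ψ z' F') : ActsBy ψ (z + z') (F + F') := by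
  intro n j m
  rw [map_add, map_add, map_add, map_add, LinearMap.add_apply, h n j m, h' n j m, add_smul]

protected theorem mul (h : ActsBy ψ z F) (h' : ActsBy ψ z' F') : ActsBy ψ (z * z') (F * F') := by
  intro n j m
  rw [map_mul, coeff_mul, coeff_mul, map_sum, LinearMap.sum_apply, Finset.sum_smul]
  refine Finset.sum_congr rfl fun p _ ↦ ?_
  rw [Module.End.mul_apply, h' n j p.2, map_smul, h n j p.1, smul_smul, map_mul, mul_comm]

theorem X_mul (h : ActsBy ψ z F) : ActsBy ψ (X * z) (X * F) := by
  intro n j m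
  rw [← seriesAlgebra_X_smul (K := K), map_smul, seriesAlgebra_X_smul]
  cases m with
  | zero => simp
  | succ m => rw [coeff_succ_X_mul, coeff_succ_X_mul, h n j m]

theorem scalar (c : K) :
    ActsBy ψ (C (algebraMap K (Ua K) c)) (C (MvPolynomial.C c)) := by
  intro n j m
  rw [uhaAction_C, AlgHom.commutes, PowerSeries.algebraMap_apply, coeff_C, coeff_C]
  split_ifs
  · rw [Module.algebraMap_end_apply, MvPolynomial.eval_C]
  · rw [map_zero, zero_smul, LinearMap.zero_apply]

theorem genUa_H :
    ActsBy ψ (C (genUa K Gen.H)) (C (MvPolynomial.X 1 - 2 * MvPolynomial.X 0)) := by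
  intro n j m
  rw [uhaAction_C, uaAction_genUa, coeff_genAction_H, coeff_C]
  congr 1
  split_ifs <;> simp

theorem Xm_mul_Xp [CharZero K] {P : (MvPolynomial (Fin 2) K)⟦X⟧}
    (hP : ∀ k : ℕ, 1 ≤ k → ∀ n : ℤ,
      ψ.val k n = PowerSeries.map (MvPolynomial.eval ![(k : K), (n : K)]) P) :
    ActsBy ψ (C (genUa K Gen.Xm * genUa K Gen.Xp)) P := by
  intro n j m
  rw [uhaAction_C, map_mul, uaAction_genUa, uaAction_genUa, coeff_genAction_Xm_mul_Xp,
    valCoeff_eq_eval hP]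

theorem of_approx (h : ∀ m, ∃ z' F', ActsBy ψ z' F' ∧ (∀ i ≤ m, coeff i z = coeff i z') ∧
    ∀ i ≤ m, coeff i F = coeff i F') : ActsBy ψ z F := by
  intro n j m
  obtain ⟨z', F', h', hz, hF⟩ := h m
  rw [coeff_uhaAction_congr hz, hF m le_rfl, h' n j m]

end ActsBy

/-- The property that `b` acts on the deformed Verma modules by a series of polynomials in `(j, n)`
that are invariant under the reflection, the constant term of which is `q`. -/
def ActsByInvariant (ψ : Colouring K) (b : Ua K) (q : MvPolynomial (Fin 2) K) : Prop :=
  ∃ F : (MvPolynomial (Fin 2) K)⟦X⟧, ActsBy ψ (C b) F ∧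
    (∀ m, coeff m F ∈ reflectInvariants K) ∧ constantCoeff F = q

namespace ActsByInvariant

variable {ψ : Colouring K} {b b' : Ua K} {q q' : MvPolynomial (Fin 2) K}

theorem coeff_C_mem (hq : q ∈ reflectInvariants K) (m : ℕ) :
    coeff m (C q) ∈ reflectInvariants K := by
  rw [coeff_C]
  split_ifs
  · exact hq
  · exact zero_mem _

protected theorem add (h : ActsByInvariant ψ b q) (h' : ActsByInvariant ψ b' q') :
    ActsByInvariant ψ (b + b') (q + q') := by
  obtain ⟨F, h, hF, rfl⟩ := h
  obtain ⟨F', h', hF', rfl⟩ := h'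
  refine ⟨F + F', ?_, fun m ↦ ?_, map_add _ _ _⟩
  · rw [map_add]
    exact h.add h'
  · rw [map_add]
    exact add_mem (hF m) (hF' m)

protected theorem mul (h : ActsByInvariant ψ b q) (h' : ActsByInvariant ψ b' q') :
    ActsByInvariant ψ (b * b') (q * q') := by
  obtain ⟨F, h, hF, rfl⟩ := h
  obtain ⟨F', h', hF', rfl⟩ := h'
  refine ⟨F * F', ?_, fun m ↦ ?_, map_mul _ _ _⟩
  · rw [map_mul]
    exact h.mul h'
  · rw [coeff_mul]
    exact sum_mem fun p _ ↦ mul_mem (hF p.1) (hF' p.2)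

theorem scalar (c : K) : ActsByInvariant ψ (algebraMap K (Ua K) c) (MvPolynomial.C c) :=
  ⟨_, .scalar c, coeff_C_mem (AlgHom.commutes _ c), constantCoeff_C _⟩

theorem genUa_H :
    ActsByInvariant ψ (genUa K Gen.H) (MvPolynomial.X 1 - 2 * MvPolynomial.X 0) := by
  refine ⟨_, .genUa_H, coeff_C_mem ?_, constantCoeff_C _⟩
  rw [mem_reflectInvariants, ← weightCasimir_X_zero, reflectVar_weightCasimir]

/-- The Casimir element `4 X⁻ X⁺ + (H + 1)²` acts by `(n + 1)²` modulo `h`. -/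
theorem exists_casimir [CharZero K] {P : (MvPolynomial (Fin 2) K)⟦X⟧}
    (hP : ∀ k : ℕ, 1 ≤ k → ∀ n : ℤ,
      ψ.val k n = PowerSeries.map (MvPolynomial.eval ![(k : K), (n : K)]) P) :
    ∃ b, ActsByInvariant ψ b ((MvPolynomial.X 1 + 1) ^ 2) := by
  have hX : ActsByInvariant ψ (genUa K Gen.Xm * genUa K Gen.Xp)
      (MvPolynomial.X 0 * (MvPolynomial.X 1 - MvPolynomial.X 0 + 1)) :=
    ⟨P, .Xm_mul_Xp hP, coeff_mem_reflectInvariants hP, constantCoeff_eq_of_regular hP⟩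
  have hH := (genUa_H (ψ := ψ)).add (scalar 1)
  have h := ((scalar 4).mul hX).add (hH.mul hH)
  rw [map_ofNat MvPolynomial.C, MvPolynomial.C_1] at h
  exact ⟨_, by convert! h using 1; ring⟩

/-- The action of `K[H, Ω]`, where `Ω` is the Casimir element, yields modulo `h` every invariant
of the reflection. -/
theorem exists_of_mem_reflectInvariants [CharZero K] {P : (MvPolynomial (Fin 2) K)⟦X⟧}
    (hP : ∀ k : ℕ, 1 ≤ k → ∀ n : ℤ,
      ψ.val k n = PowerSeries.map (MvPolynomial.eval ![(k : K), (n : K)]) P)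
    (hq : q ∈ reflectInvariants K) : ∃ b, ActsByInvariant ψ b q := by
  obtain ⟨a, rfl⟩ := exists_weightCasimir_eq hq
  clear hq
  induction a using MvPolynomial.induction_on with
  | C c =>
    refine ⟨algebraMap K (Ua K) c, ?_⟩
    rw [MvPolynomial.algHom_C, MvPolynomial.algebraMap_eq]
    exact scalar c
  | add a a' ha ha' =>
    obtain ⟨b, hb⟩ := ha
    obtain ⟨b', hb'⟩ := ha'
    refine ⟨b + b', ?_⟩
    rw [map_add]
    exact hb.add hb'
  | mul_X a i ha =>
    obtain ⟨b, hb⟩ := ha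
    fin_cases i
    · refine ⟨b * genUa K Gen.H, ?_⟩
      rw [map_mul]
      simp only [Fin.zero_eta, weightCasimir_X_zero]
      exact hb.mul genUa_H
    · obtain ⟨b', hb'⟩ := exists_casimir hP
      refine ⟨b * b', ?_⟩
      rw [map_mul]
      simp only [Fin.mk_one, weightCasimir_X_one]
      exact hb.mul hb'

end ActsByInvariant

theorem exists_actsBy [CharZero K] {ψ : Colouring K} {P : (MvPolynomial (Fin 2) K)⟦X⟧}
    (hP : ∀ k : ℕ, 1 ≤ k → ∀ n : ℤ,
      ψ.val k n = PowerSeries.map (MvPolynomial.eval ![(k : K), (n : K)]) P)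
    {F : (MvPolynomial (Fin 2) K)⟦X⟧} (hF : ∀ m, coeff m F ∈ reflectInvariants K) :
    ∃ z, ActsBy ψ z F := by
  let ofA : Series (Ua K) → Uha K := fun z ↦ PowerSeries.mk fun m ↦ z.coeff m
  let ofB : Series (reflectInvariants K) → (MvPolynomial (Fin 2) K)⟦X⟧ := fun F ↦
    PowerSeries.mk fun m ↦ ((F.coeff m : reflectInvariants K) : MvPolynomial (Fin 2) K)
  obtain ⟨z, hz⟩ := exists_series_of_solvable_mod (fun z F ↦ ActsBy ψ (ofA z) (ofB F))
    (by
      intro z z' F F' h h'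
      convert h.add h' using 1
      · ext m
        simp [ofA]
      · ext m : 1
        simp [ofB])
    (by
      intro z F h
      convert h.X_mul using 1
      · ext m
        cases m <;> simp [ofA, coeff_succ_X_mul]
      · ext m : 1
        cases m <;> simp [ofB, coeff_succ_X_mul])
    (by
      intro z F h
      refine .of_approx fun m ↦ ?_
      obtain ⟨z', F', h', hz, hF⟩ := h m
      refine ⟨_, _, h', fun i hi ↦ ?_, fun i hi ↦ ?_⟩
      · simp [ofA, hz i hi]
      · simp [ofB, hF i hi])
    (by
      rintro ⟨p, hp⟩
      obtain ⟨b, F, h, hmem, hF0⟩ := ActsByInvariant.exists_of_mem_reflectInvariants hP hp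
      refine ⟨b, Series.mk fun m ↦ ⟨coeff m F, hmem m⟩, ?_, ?_⟩
      · convert h using 1
        · ext m
          by_cases hm : m = 0 <;> simp [ofA, Series.const, coeff_C, hm]
        · ext m : 1
          simp [ofB]
      · apply Subtype.ext
        simp [hF0])
    (Series.mk fun m ↦ ⟨coeff m F, hF m⟩)
  refine ⟨ofA z, ?_⟩
  convert hz using 1
  ext m : 1
  simp [ofB]

/-- For a regular colouring, `X⁺ X⁻ - X⁻ X⁺ - H` acts on `b_j` by a multiple of `h` whose
coefficients are polynomials in `(j, n)` invariant under the reflection, hence as `h y` for some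
`y` in `U_h(a)`. -/
theorem exists_sl2Relator_of_isRegular [CharZero K] {ψ : Colouring K} (hψ : ψ.IsRegular) :
    ∃ y, C (sl2Relator K) - X * y ∈ Ih ψ := by
  obtain ⟨P, hP⟩ := hψ
  obtain ⟨y, hy⟩ := exists_actsBy hP
    (F := PowerSeries.mk fun m ↦ shiftVar 1 (coeff (m + 1) P) - coeff (m + 1) P) (by
      intro m
      rw [coeff_mk]
      refine sub_mem ?_ (coeff_mem_reflectInvariants hP _)
      rw [mem_reflectInvariants, reflectVar_shiftVar,
        mem_reflectInvariants.mp (coeff_mem_reflectInvariants hP _)])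
  refine ⟨y, mem_Ih.mpr fun n ↦ ?_⟩
  rw [map_sub, uhaAction_C, sub_eq_zero]
  ext m : 1
  refine Finsupp.lhom_ext' fun j ↦ LinearMap.ext_ring ?_
  change coeff m (uaAction ψ n (sl2Relator K)) (Finsupp.single j 1) =
    coeff m (uhaAction ψ n (X * y)) (Finsupp.single j 1)
  rw [hy.X_mul n j m, coeff_sl2Relator, valCoeff_eq_eval hP, valCoeff_eq_eval hP]
  congr 1
  cases m with
  | zero =>
    rw [coeff_zero_X_mul, if_pos rfl, coeff_zero_eq_constantCoeff_apply,
      constantCoeff_eq_of_regular hP]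
    simp
    ring
  | succ m =>
    rw [coeff_succ_X_mul, coeff_mk, if_neg (by omega), sub_zero, map_sub, eval_shiftVar,
      ← Nat.cast_add_one]

end

end CKM

theorem mainTheorem1 {K : Type u} [Field K] [CharZero K] (ψ : CKM.Colouring K) :
    List.TFAE
      [ψ.IsRegular,
       CKM.IsFormalDeformation K (CKM.Usl2 K) (CKM.Uh ψ),
       CKM.IsFormalDeformationOver K (CKM.UaToUsl2 K)
         (Ideal.Quotient.mkₐ K⟦X⟧ (CKM.Ih ψ))] := by
  tfae_have 1 → 3 := fun h ↦
    CKM.isFormalDeformationOver_iff.mpr (CKM.exists_sl2Relator_of_isRegular h)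
  tfae_have 3 → 2 := fun ⟨h, e, _⟩ ↦ ⟨h, ⟨e.symm⟩⟩
  tfae_have 2 → 3 := CKM.isFormalDeformationOver_of_isFormalDeformation
  tfae_have 3 → 1 := fun h ↦
    (CKM.isFormalDeformationOver_iff.mp h).elim fun _ ↦ CKM.isRegular_of_sl2Relator
  tfae_finish
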